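/- Let $X$ be a smooth, projective, geometrically irreducible curve over the finite field $\mathbb{F}_q$ with function field $K$, let $\infty\in X(\mathbb{F}_q)$, and let $A=\mathcal{O}_X(X\setminus\{\infty\})$. Let $v_\infty$ be the normalized valuation of $K$ at $\infty$, let $K_\infty$ be the completion of $K$ for the norm $\|x\|=q^{-v_\infty(x)}$, and let $\mathbb{C}_\infty$ be the completion of an algebraic closure of $K_\infty$. Write $\tau:x\mapsto x^q$ for the Frobenius automorphism of $\mathbb{C}_\infty$. Let $\Lambda\subseteq\mathbb{C}_\infty$ be a finitely generated discrete $A$-submodule, and write its exponential as $$\exp_\Lambda(x)=x\prod_{\lambda\in\Lambda\setminus\{0\}}\Bigl(1-\frac{x}{\lambda}\Bigr)=\sum_{i\ge 0}e_i x^{q^i},\qquad\text{i.e. } \exp_\Lambda=\sum_{i\ge0} e_i\tau^i\in\mathbb{C}_\infty[[\tau]].$$ For $f=\sum_i f_i\tau^i\in\mathbb{C}_\infty[[\tau]]$ put $f^*=\sum_i\tau^{-i}f_i=\sum_i f_i^{q^{-i}}\tau^{-i}\in\mathbb{C}_\infty[[\tau^{-1}]]$. Let $\ker\exp_\Lambda^*$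 be the set of $\beta\in\mathbb{C}_\infty$ with $\sum_i (e_i\beta)^{q^{-i}}=0$. For $\beta\in\mathbb{C}_\infty$ let $g_\beta\in\mathbb{C}_\infty[[\tau]]$ be the unique series with $\exp_\Lambda^*\circ\beta=g_\beta^*\circ(1-\tau^{-1})$ in $\mathbb{C}_\infty[[\tau^{-1}]]$ (so $g_0=0$). (1) For every $\beta\in\ker\exp_\Lambda^*$ with $\beta\neq0$, the series $g_\beta$ converges at every $\lambda\in\Lambda$, and $$\beta=-\sum_{\lambda\in\Lambda\setminus\{0\}}\frac{g_\beta(\lambda)}{\lambda},$$ where the sum converges unconditionally in $\mathbb{C}_\infty$. (2) This gives an explicit inverse of Poonen's map: $\beta\mapsto g_\beta|_\Lambda$ is a bijection from $\ker\exp_\Lambda^*$ onto the set $\mathrm{Hom}_{\mathbb{F}_q}(\Lambda,\mathbb{F}_q)$ of $\mathbb{F}_q$-linear maps, and its inverse sends $f$ to $-\sum_{\lambda\in\Lambda\setminus\{0\}}f(\lambda)/\lambda$, the sum converging unconditionally. -/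

import Mathlib

noncomputable section

/-! ## The curve, the point at infinity, and the ring `A`

A smooth projective geometrically irreducible curve over the finite field `Fq` is given by its
function field `K`; its closed points are the discrete valuation rings of `K` over `Fq`. -/

/-- `K` is the function field of a smooth, projective, geometrically irreducible curve over `Fq`:
a finitely generated extension of transcendence degree one in which `Fq` is algebraically closed. -/
structure IsCurveFunctionField (Fq K : Type*) [Field Fq] [Field K] [Algebra Fq K] : Prop where
  finitelyGenerated : (⊤ : IntermediateField Fq K).FG
  trdeg_eq_one : Algebra.trdeg Fq K = 1
  constants : ∀ x : K, IsAlgebraic Fq x → x ∈ Set.range (algebraMap Fq K)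

/-- A closed point of the curve with function field `K`: its local ring in `K`. -/
@[ext]
structure ClosedPoint (Fq K : Type*) [Field Fq] [Field K] [Algebra Fq K] where
  localRing : ValuationSubring K
  algebraMap_mem : ∀ c : Fq, algebraMap Fq K c ∈ localRing
  isDVR : IsDiscreteValuationRing localRing

attribute [instance] ClosedPoint.isDVR

namespace ClosedPoint

variable {Fq K : Type*} [Field Fq] [Field K] [Algebra Fq K]

/-- The point is `Fq`-rational: its residue field is `Fq`. -/
def IsRational (P : ClosedPoint Fq K) : Prop :=
  ∀ x ∈ P.localRing, ∃ c : Fq, P.localRing.valuation (x - algebraMap Fq K c) < 1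

/-- The ring `A` of functions which are regular away from the point `P`. -/
def ringAway (P : ClosedPoint Fq K) : Subalgebra Fq K where
  carrier := {x | ∀ Q : ClosedPoint Fq K, Q ≠ P → x ∈ Q.localRing}
  mul_mem' ha hb Q hQ := mul_mem (ha Q hQ) (hb Q hQ)
  add_mem' ha hb Q hQ := add_mem (ha Q hQ) (hb Q hQ)
  algebraMap_mem' c Q _ := Q.algebraMap_mem c

variable [Fintype Fq]

/-- The norm `‖x‖ = q ^ (-v(x))` on `K`, with `v` the normalized valuation at the point `P`. -/
def abv (P : ClosedPoint Fq K) : AbsoluteValue K ℝ :=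
  (IsDiscreteValuationRing.maximalIdeal P.localRing).adicAbv (K := K)
    (b := (Fintype.card Fq : NNReal)) (by exact_mod_cast Fintype.one_lt_card)

theorem isNonarchimedean_abv (P : ClosedPoint Fq K) : IsNonarchimedean P.abv :=
  IsDedekindDomain.HeightOneSpectrum.isNonarchimedean_adicAbv _ _

/-- The completion `K_∞` of `K` at the point `P`. -/
abbrev KInf (P : ClosedPoint Fq K) : Type _ := P.abv.Completion

instance (P : ClosedPoint Fq K) : IsUltrametricDist (WithAbs P.abv) :=
  IsUltrametricDist.isUltrametricDist_of_forall_norm_add_le_max_norm fun x y =>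
    P.isNonarchimedean_abv x.ofAbs y.ofAbs

instance (P : ClosedPoint Fq K) : IsUltrametricDist P.KInf :=
  IsUltrametricDist.isUltrametricDist_of_forall_norm_add_le_max_norm fun x y => by
    induction x, y using UniformSpace.Completion.induction_on₂ with
    | hp => exact isClosed_le (by fun_prop) (by fun_prop)
    | ih x y =>
      rw [← UniformSpace.Completion.coe_add]
      simpa only [UniformSpace.Completion.norm_coe] using
        IsUltrametricDist.norm_add_le_max x y

instance (P : ClosedPoint Fq K) : NontriviallyNormedField P.KInf where
  non_trivial := by
    obtain ⟨π, hπ⟩ := IsDedekindDomain.HeightOneSpectrum.valuation_exists_uniformizer K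
      (IsDiscreteValuationRing.maximalIdeal P.localRing)
    have hlt : P.abv π < 1 := by
      have h1 : (1 : NNReal) < (Fintype.card Fq : NNReal) := by exact_mod_cast Fintype.one_lt_card
      have h2 := (WithZeroMulInt.toNNReal_lt_one_iff (m :=
        (IsDiscreteValuationRing.maximalIdeal P.localRing).valuation K π) h1).2 (by
          rw [hπ, ← WithZero.exp_zero, WithZero.exp_lt_exp]; norm_num)
      exact_mod_cast h2
    have hpos : 0 < P.abv π := P.abv.pos (by
      rintro rfl
      rw [map_zero] at hπ
      exact WithZero.exp_ne_zero hπ.symm)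
    refine ⟨((WithAbs.toAbs P.abv π⁻¹ : WithAbs P.abv) : P.KInf), ?_⟩
    rw [UniformSpace.Completion.norm_coe]
    change 1 < P.abv π⁻¹
    rw [map_inv₀]
    exact (one_lt_inv₀ hpos).2 hlt

/-- The algebraic closure of `K_∞`. -/
abbrev KInfAlg (P : ClosedPoint Fq K) : Type _ := AlgebraicClosure P.KInf

instance (P : ClosedPoint Fq K) : NontriviallyNormedField P.KInfAlg :=
  spectralNorm.nontriviallyNormedField P.KInf P.KInfAlg

/-- The field `ℂ_∞`: the completion of the algebraic closure of `K_∞` for the unique extension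
of the norm of `K_∞`. -/
def CInf (P : ClosedPoint Fq K) : Type _ := UniformSpace.Completion P.KInfAlg

instance (P : ClosedPoint Fq K) : NontriviallyNormedField P.CInf where
  __ := (inferInstance : NormedField (UniformSpace.Completion P.KInfAlg))
  non_trivial := by
    obtain ⟨x, hx⟩ := NontriviallyNormedField.non_trivial (α := P.KInfAlg)
    exact ⟨(x : UniformSpace.Completion P.KInfAlg), by
      simpa [UniformSpace.Completion.norm_coe] using! hx⟩

instance (P : ClosedPoint Fq K) : CompleteSpace P.CInf :=
  inferInstanceAs (CompleteSpace (UniformSpace.Completion P.KInfAlg))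

instance (P : ClosedPoint Fq K) : Algebra P.KInfAlg P.CInf :=
  inferInstanceAs (Algebra P.KInfAlg (UniformSpace.Completion P.KInfAlg))

/-- The embedding `K → K_∞ → ℂ_∞`. -/
def toCInf (P : ClosedPoint Fq K) : K →+* P.CInf :=
  (algebraMap P.KInfAlg P.CInf).comp <| (algebraMap P.KInf P.KInfAlg).comp <|
    (algebraMap (WithAbs P.abv) P.KInf).comp (WithAbs.equiv P.abv).symm.toRingHom

instance (P : ClosedPoint Fq K) : Algebra K P.CInf := P.toCInf.toAlgebra

instance (P : ClosedPoint Fq K) : Algebra Fq P.CInf :=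
  (P.toCInf.comp (algebraMap Fq K)).toAlgebra

instance (P : ClosedPoint Fq K) : IsScalarTower Fq K P.CInf :=
  IsScalarTower.of_algebraMap_eq fun _ => rfl

instance (P : ClosedPoint Fq K) : IsScalarTower Fq P.ringAway P.CInf :=
  IsScalarTower.of_algebraMap_eq fun _ => rfl

theorem pow_card_surjective (P : ClosedPoint Fq K) :
    Function.Surjective fun x : P.CInf => x ^ Fintype.card Fq := by
  intro c
  have hq : Fintype.card Fq ≠ 0 := Fintype.card_ne_zero
  have hdense : DenseRange (algebraMap P.KInfAlg P.CInf) :=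
    UniformSpace.Completion.denseRange_coe (α := P.KInfAlg)
  obtain ⟨u, hu, hlim⟩ := mem_closure_iff_seq_limit.1 (hdense c)
  have hroot (n : ℕ) : ∃ v : P.CInf, v ^ Fintype.card Fq = u n := by
    obtain ⟨w, hw⟩ := hu n
    obtain ⟨z, hz⟩ := IsAlgClosed.exists_pow_nat_eq w (Fintype.card_pos (α := Fq))
    exact ⟨algebraMap P.KInfAlg P.CInf z, by rw [← map_pow, hz, hw]⟩
  choose v hv using hroot
  have hdist (m n : ℕ) : dist (v m) (v n) ^ Fintype.card Fq = dist (u m) (u n) := by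
    rw [dist_eq_norm, dist_eq_norm, ← norm_pow, ← hv, ← hv]
    exact congrArg norm (map_sub (FiniteField.frobeniusAlgHom Fq P.CInf) (v m) (v n))
  have hcauchy : CauchySeq v := by
    rw [Metric.cauchySeq_iff']
    intro ε hε
    obtain ⟨N, hN⟩ := Metric.cauchySeq_iff'.1 hlim.cauchySeq (ε ^ Fintype.card Fq) (by positivity)
    refine ⟨N, fun n hn => lt_of_pow_lt_pow_left₀ (Fintype.card Fq) hε.le ?_⟩
    rw [hdist]
    exact hN n hn
  obtain ⟨x, hx⟩ := cauchySeq_tendsto_of_complete hcauchy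
  refine ⟨x, tendsto_nhds_unique (hx.pow (Fintype.card Fq)) ?_⟩
  simpa only [hv] using hlim

/-- The Frobenius automorphism `τ : x ↦ x ^ q` of `ℂ_∞`. -/
def frob (P : ClosedPoint Fq K) : P.CInf ≃+* P.CInf :=
  RingEquiv.ofBijective (FiniteField.frobeniusAlgHom Fq P.CInf)
    ⟨(FiniteField.frobeniusAlgHom Fq P.CInf).toRingHom.injective,
      P.pow_card_surjective⟩

end ClosedPoint

/-! ## Twisted power series -/

/-- Twisted power series `∑ aᵢ σⁱ` over a ring `R` with automorphism `σ`, where `σ ∘ a = σ(a) σ`.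
For `σ = τ` this is `R[[τ]]`, for `σ = τ⁻¹` it is `R[[τ⁻¹]]`. -/
@[ext]
structure TwistedSeries {R : Type*} [CommRing R] (σ : R ≃+* R) where
  coeff : ℕ → R

namespace TwistedSeries

variable {R : Type*} [CommRing R] {σ : R ≃+* R}

/-- The composition product: `(∑ aᵢ σⁱ) (∑ bⱼ σʲ) = ∑ aᵢ σⁱ(bⱼ) σⁱ⁺ʲ`. -/
instance : Mul (TwistedSeries σ) where
  mul F G := ⟨fun n => ∑ ij ∈ Finset.HasAntidiagonal.antidiagonal n, F.coeff ij.1 * σ^[ij.1] (G.coeff ij.2)⟩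

/-- The constant series `a`, that is, multiplication by `a`. -/
def const (a : R) : TwistedSeries σ := ⟨fun n => if n = 0 then a else 0⟩

/-- The series `1 - σ`. -/
def oneSub : TwistedSeries σ := ⟨fun n => if n = 0 then 1 else if n = 1 then -1 else 0⟩

/-- The adjoint `(∑ aᵢ σⁱ)^* = ∑ σ⁻ⁱ aᵢ = ∑ σ⁻ⁱ(aᵢ) σ⁻ⁱ`. -/
def adjoint (F : TwistedSeries σ) : TwistedSeries σ.symm := ⟨fun n => σ.symm^[n] (F.coeff n)⟩

/-- The series `∑ aᵢ σⁱ` converges at `x`, with value `y = ∑ aᵢ σⁱ(x)`. -/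
def HasEval [TopologicalSpace R] (F : TwistedSeries σ) (x y : R) : Prop :=
  HasSum (fun n => F.coeff n * σ^[n] x) y

/-- The value `∑ aᵢ σⁱ(x)`. -/
def eval [TopologicalSpace R] (F : TwistedSeries σ) (x : R) : R :=
  ∑' n, F.coeff n * σ^[n] x

theorem coeff_zero_mul_oneSub (F : TwistedSeries σ) :
    (F * oneSub).coeff 0 = F.coeff 0 := by
  change ∑ ij ∈ Finset.HasAntidiagonal.antidiagonal 0, _ = _
  simp [oneSub]

theorem coeff_succ_mul_oneSub (F : TwistedSeries σ) (n : ℕ) :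
    (F * oneSub).coeff (n + 1) = F.coeff (n + 1) - F.coeff n := by
  change ∑ ij ∈ Finset.HasAntidiagonal.antidiagonal (n + 1), _ = _
  rw [Finset.Nat.sum_antidiagonal_succ']
  cases n with
  | zero => simp [oneSub, sub_eq_add_neg]
  | succ n =>
    rw [Finset.Nat.sum_antidiagonal_succ']
    simp [oneSub, iterate_map_zero, iterate_map_one, iterate_map_neg, sub_eq_add_neg]

/-- Every series in `R[[σ⁻¹]]` is divisible on the right by `1 - σ⁻¹`, in a unique way. -/
theorem existsUnique_adjoint_mul_oneSub (H : TwistedSeries σ.symm) :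
    ∃! g : TwistedSeries σ, H = g.adjoint * oneSub := by
  have hl (n : ℕ) (x : R) : σ.symm^[n] (σ^[n] x) = x :=
    (Function.LeftInverse.iterate σ.symm_apply_apply n) x
  refine ⟨⟨fun n => σ^[n] (∑ i ∈ Finset.range (n + 1), H.coeff i)⟩, ?_, ?_⟩
  · ext n
    cases n with
    | zero => rw [coeff_zero_mul_oneSub]; simp [adjoint]
    | succ n =>
      rw [coeff_succ_mul_oneSub]
      simp only [adjoint, hl]
      rw [Finset.sum_range_succ _ (n + 1)]
      ring
  · intro g hg
    have key (n : ℕ) : g.adjoint.coeff n = ∑ i ∈ Finset.range (n + 1), H.coeff i := by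
      induction n with
      | zero => rw [hg, Finset.sum_range_one, coeff_zero_mul_oneSub]
      | succ n ih =>
        rw [Finset.sum_range_succ, ← ih, congrArg (fun F => F.coeff (n + 1)) hg]
        rw [coeff_succ_mul_oneSub]
        ring
    ext n
    have hinj : Function.Injective (σ.symm^[n]) := σ.symm.injective.iterate n
    apply hinj
    rw [hl]
    exact key n

end TwistedSeries

/-! ## The exponential of a lattice, its dual, and Poonen's series -/

namespace ClosedPoint

variable {Fq K : Type*} [Field Fq] [Field K] [Algebra Fq K] [Fintype Fq]
  {P : ClosedPoint Fq K}

open scoped PowerSeries.WithPiTopology in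
/-- The exponential `exp_Λ = x ∏_{λ ∈ Λ ∖ {0}} (1 - x / λ)` in `ℂ_∞[[x]]`; the infinite product
is taken coefficientwise. -/
def expPowerSeries (Λ : Submodule P.ringAway P.CInf) : PowerSeries P.CInf :=
  PowerSeries.X * ∏' l : {l : Λ // l ≠ 0},
    (1 - PowerSeries.C ((l : Λ) : P.CInf)⁻¹ * PowerSeries.X)

/-- The exponential as the element `∑ eᵢ τⁱ` of `ℂ_∞[[τ]]`, with `eᵢ` the coefficient of
`x ^ (q ^ i)`. -/
def expSeries (Λ : Submodule P.ringAway P.CInf) : TwistedSeries P.frob :=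
  ⟨fun i => PowerSeries.coeff (Fintype.card Fq ^ i) (expPowerSeries Λ)⟩

/-- The dual exponential `exp_Λ^* = ∑ τ⁻ⁱ eᵢ` in `ℂ_∞[[τ⁻¹]]`. -/
def dualExpSeries (Λ : Submodule P.ringAway P.CInf) : TwistedSeries P.frob.symm :=
  (expSeries Λ).adjoint

/-- The kernel of the dual exponential, in `ℂ_∞`. -/
def kerDualExp (Λ : Submodule P.ringAway P.CInf) : Set P.CInf :=
  {β | (dualExpSeries Λ).HasEval β 0}

theorem existsUnique_poonenSeries (Λ : Submodule P.ringAway P.CInf) (β : P.CInf) :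
    ∃! g : TwistedSeries P.frob,
      dualExpSeries Λ * TwistedSeries.const β = g.adjoint * TwistedSeries.oneSub :=
  TwistedSeries.existsUnique_adjoint_mul_oneSub _

/-- Poonen's series `g_β`: the unique `g` in `ℂ_∞[[τ]]` with `exp_Λ^* ∘ β = g^* ∘ (1 - τ⁻¹)`. -/
def poonenSeries (Λ : Submodule P.ringAway P.CInf) (β : P.CInf) : TwistedSeries P.frob :=
  (existsUnique_poonenSeries Λ β).choose

theorem poonenSeries_spec (Λ : Submodule P.ringAway P.CInf) (β : P.CInf) :
    dualExpSeries Λ * TwistedSeries.const β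
      = (poonenSeries Λ β).adjoint * TwistedSeries.oneSub :=
  (existsUnique_poonenSeries Λ β).choose_spec.1

end ClosedPoint

end

/-! For an `Fq`-linear form `f` on `Λ`, let `h_m` be the linearized polynomial of small degree which
interpolates `f` on the finite group `Λ_m` of lattice points of norm at most `m`, and `E_m` the
exponential polynomial of `Λ_m`. Since `f` takes values in `Fq`, the polynomial `h_m - h_m ^ q`
vanishes on `Λ_m`, so comparing degrees it equals `β_m E_m`, where `β_m` is the linear coefficient
of `h_m`; Lagrange interpolation shows that `β_m = -∑ f(λ) / λ` over the nonzero `λ ∈ Λ_m`. Letting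
`m` tend to infinity, `β_m` tends to `β = -∑ f(λ) / λ`, and `h_m` tends to an entire series `g` with
values `f` on `Λ` and `g - g ^ q = β exp_Λ`. The latter equation characterizes Poonen's series
`g_β`, and `β` lies in the kernel of `exp_Λ^*` exactly when `g_β` is entire.

Conversely, if `g_β` is entire, then its values on `Λ` satisfy `y = y ^ q`, hence lie in `Fq`. It
remains to see that they determine `β`, that is, `β = 0` when `g_β` vanishes on `Λ`. In that case
let `M` be the maximum of `|g_β|` on the disk of radius `r` and `G` the product of `r` and of
`r / |λ|` over the nonzero `λ ∈ Λ` with `|λ| < r`. Dividing out zeros (the Schwarz lemma) gives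
`|β| G ≤ M`, while `g_β - g_β ^ q = β exp_Λ` gives `M ^ q ≤ max 1 (|β| G)`. Hence
`|β| r ≤ |β| G ≤ 1` for every `r`. -/

noncomputable section

open Polynomial Filter Topology

/-! ## Linearized polynomials -/

section Linearized

variable {Fq R C : Type*} [Fintype Fq] [CommRing R]

variable (Fq R) in
/-- The linearized polynomials `∑ aᵢ X ^ (q ^ i)` with coefficients in `R`, where `q` is the order
of `Fq`: the polynomials in the Frobenius. -/
def linearized : Submodule R R[X] :=
  Submodule.span R (Set.range fun i : ℕ => (X ^ Fintype.card Fq ^ i : R[X]))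

theorem X_mem_linearized : (X : R[X]) ∈ linearized Fq R :=
  Submodule.subset_span ⟨0, by simp only [pow_zero, pow_one]⟩

theorem hasSum_eval_of_mem_linearized [Nontrivial Fq] [TopologicalSpace R]
    [IsTopologicalSemiring R] {P : R[X]} (hP : P ∈ linearized Fq R) (x : R) :
    HasSum (fun n => P.coeff (Fintype.card Fq ^ n) * x ^ Fintype.card Fq ^ n) (P.eval x) := by
  induction hP using Submodule.span_induction with
  | mem P hP =>
    obtain ⟨i, rfl⟩ := hP
    have h := hasSum_ite_eq i (x ^ Fintype.card Fq ^ i)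
    convert h using 2 with n
    · have := (Nat.pow_right_injective (Fintype.one_lt_card (α := Fq))).eq_iff (a := n) (b := i)
      by_cases hn : n = i <;> simp_all [coeff_X_pow]
    · rw [eval_pow, eval_X]
  | zero => simpa only [coeff_zero, zero_mul, eval_zero] using hasSum_zero
  | add P Q _ _ hP hQ => simpa only [coeff_add, add_mul, eval_add] using hP.add hQ
  | smul c P _ hP =>
    simpa only [coeff_smul, smul_eq_mul, mul_assoc, eval_smul] using hP.mul_left c

variable [Field Fq] [Algebra Fq R] [Field C] [Algebra Fq C]

theorem frobeniusAlgHom_pow_apply (i : ℕ) (x : R) :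
    (FiniteField.frobeniusAlgHom Fq R ^ i) x = x ^ Fintype.card Fq ^ i := by
  rw [AlgHom.coe_pow, FiniteField.coe_frobeniusAlgHom, pow_iterate]

theorem exists_algebraMap_eq_of_pow_card_eq {y : C} (hy : y ^ Fintype.card Fq = y) :
    ∃ a : Fq, algebraMap Fq C a = y := by
  have hsplits : (X ^ Fintype.card Fq - X : Fq[X]).Splits := by
    rw [splits_iff_card_roots, FiniteField.roots_X_pow_card_sub_X,
      FiniteField.X_pow_card_sub_X_natDegree_eq Fq Fintype.one_lt_card]
    rfl
  refine hsplits.mem_range_of_isRoot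
    (FiniteField.X_pow_card_sub_X_ne_zero Fq Fintype.one_lt_card) (x := y) ?_
  simp [hy]

theorem pow_card_eq_map_expand (P : R[X]) :
    P ^ Fintype.card Fq =
      (expand R (Fintype.card Fq) P).map (FiniteField.frobeniusAlgHom Fq R).toRingHom := by
  induction P using Polynomial.induction_on' with
  | add P Q hP hQ =>
    rw [map_add, Polynomial.map_add, ← hP, ← hQ]
    exact map_add (FiniteField.frobeniusAlgHom Fq R[X]) P Q
  | monomial k a =>
    rw [monomial_pow, expand_monomial, map_monomial, mul_comm]
    rfl

theorem coeff_pow_card (P : R[X]) (k : ℕ) :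
    (P ^ Fintype.card Fq).coeff (k * Fintype.card Fq) = P.coeff k ^ Fintype.card Fq := by
  rw [pow_card_eq_map_expand, coeff_map, coeff_expand_mul Fintype.card_pos]
  rfl

theorem coeff_one_pow_card (P : R[X]) : (P ^ Fintype.card Fq).coeff 1 = 0 := by
  rw [pow_card_eq_map_expand, coeff_map, coeff_expand Fintype.card_pos,
    if_neg (Nat.not_dvd_of_pos_of_lt one_pos Fintype.one_lt_card), map_zero]

theorem pow_card_mem_linearized {P : R[X]} (hP : P ∈ linearized Fq R) :
    P ^ Fintype.card Fq ∈ linearized Fq R := by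
  change FiniteField.frobeniusAlgHom Fq R[X] P ∈ _
  induction hP using Submodule.span_induction with
  | mem P hP =>
    obtain ⟨i, rfl⟩ := hP
    refine Submodule.subset_span ⟨i + 1, ?_⟩
    simp only [FiniteField.frobeniusAlgHom_apply, ← pow_mul, pow_succ]
  | zero =>
    rw [map_zero]
    exact zero_mem _
  | add P Q _ _ hP hQ => exact map_add (FiniteField.frobeniusAlgHom Fq R[X]) P Q ▸ add_mem hP hQ
  | smul c P _ hP =>
    rw [FiniteField.frobeniusAlgHom_apply, _root_.smul_pow]
    exact Submodule.smul_mem _ _ hP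

theorem isLinearMap_eval_of_mem_linearized {P : R[X]} (hP : P ∈ linearized Fq R) :
    IsLinearMap Fq fun x => P.eval x := by
  induction hP using Submodule.span_induction with
  | mem P hP =>
    obtain ⟨i, rfl⟩ := hP
    simp only [eval_pow, eval_X, ← frobeniusAlgHom_pow_apply (R := R)]
    exact (FiniteField.frobeniusAlgHom Fq R ^ i).toLinearMap.isLinear
  | zero => exact ⟨by simp, by simp⟩
  | add P Q _ _ hP hQ =>
    simp only [eval_add]
    exact (hP.mk' _ + hQ.mk' _).isLinear
  | smul c P _ hP =>
    simp only [eval_smul]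
    exact (c • hP.mk' _).isLinear

end Linearized

/-! ## Interpolation on finite subspaces -/

section Interpolation

variable {Fq C : Type*} [Field C]

/-- The polynomial `X * ∏ (1 - X / l)`, the product over the nonzero `l ∈ s`: the exponential of
the finite set `s`. The element `0` of `s` may be left in the product, since `0⁻¹ = 0`. -/
def expPoly (s : Finset C) : C[X] := X * ∏ l ∈ s, (1 - Polynomial.C l⁻¹ * X)

theorem coeff_one_expPoly (s : Finset C) : (expPoly s).coeff 1 = 1 := by
  rw [expPoly, coeff_X_mul, coeff_zero_eq_eval_zero, eval_prod]
  simp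

theorem C_mul_expPoly [DecidableEq C] {s : Finset C} (h0 : 0 ∈ s) :
    Polynomial.C (∏ l ∈ s.erase 0, -l) * expPoly s = Lagrange.nodal s id := by
  rw [Lagrange.nodal_eq, ← Finset.mul_prod_erase s _ h0, id, map_zero, sub_zero, expPoly, map_prod,
    mul_left_comm, ← Finset.prod_erase s (a := 0) (by simp), ← Finset.prod_mul_distrib]
  congr 1
  refine Finset.prod_congr rfl fun l hl => ?_
  rw [mul_sub, ← mul_assoc, ← map_mul, neg_mul, mul_inv_cancel₀ (Finset.ne_of_mem_erase hl), id,
    map_neg, map_neg, map_one]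
  ring

theorem prod_erase_zero_neg_ne_zero [DecidableEq C] (s : Finset C) : ∏ l ∈ s.erase 0, -l ≠ 0 :=
  Finset.prod_ne_zero_iff.2 fun _ hl => neg_ne_zero.2 (Finset.ne_of_mem_erase hl)

theorem natDegree_expPoly {s : Finset C} (h0 : 0 ∈ s) : (expPoly s).natDegree = s.card := by
  classical
  rw [← natDegree_C_mul (prod_erase_zero_neg_ne_zero s), C_mul_expPoly h0, Lagrange.natDegree_nodal]

theorem eval_expPoly_eq_zero_iff {s : Finset C} (h0 : 0 ∈ s) {x : C} :
    (expPoly s).eval x = 0 ↔ x ∈ s := by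
  classical
  have h := congrArg (eval x) (C_mul_expPoly h0)
  rw [eval_mul, eval_C, Lagrange.eval_nodal] at h
  rw [← mul_eq_zero_iff_left (prod_erase_zero_neg_ne_zero s), h, Finset.prod_eq_zero_iff]
  simp [sub_eq_zero]

theorem eq_C_coeff_one_mul_expPoly {s : Finset C} (h0 : 0 ∈ s) {P : C[X]}
    (hdeg : P.natDegree ≤ s.card) (hP : ∀ x ∈ s, P.eval x = 0) :
    P = Polynomial.C (P.coeff 1) * expPoly s := by
  classical
  have hnodal : P = Polynomial.C (P.coeff s.card) * Lagrange.nodal s id := by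
    refine eq_of_degree_sub_lt_of_eval_finset_eq s ?_ fun x hx => ?_
    · refine (degree_lt_iff_coeff_zero _ _).2 fun m hm => ?_
      rw [coeff_sub, coeff_C_mul]
      rcases hm.eq_or_lt with rfl | hm
      · have := (Lagrange.nodal_monic (s := s) (v := id)).coeff_natDegree
        rw [Lagrange.natDegree_nodal] at this
        rw [this, mul_one, sub_self]
      · have hlt : (Lagrange.nodal s (id : C → C)).natDegree < m := by
          rwa [Lagrange.natDegree_nodal]
        rw [coeff_eq_zero_of_natDegree_lt (hdeg.trans_lt hm), coeff_eq_zero_of_natDegree_lt hlt,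
          mul_zero, sub_zero]
    · rw [hP x hx, eval_mul, ← id_eq x, Lagrange.eval_nodal_at_node hx, mul_zero]
  rw [← C_mul_expPoly h0, ← mul_assoc, ← map_mul] at hnodal
  have hcoeff := congrArg (fun F => coeff F 1) hnodal
  simp only [coeff_C_mul, coeff_one_expPoly, mul_one] at hcoeff
  rwa [hcoeff]

variable [Field Fq] [Algebra Fq C]

theorem zero_mem_of_coe_eq {V : Submodule Fq C} {s : Finset C} (hs : (s : Set C) = V) : 0 ∈ s := by
  rw [← Finset.mem_coe, hs]
  exact V.zero_mem

theorem natCard_eq_card {V : Submodule Fq C} {s : Finset C} (hs : (s : Set C) = V) :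
    Nat.card V = s.card := by
  rw [← Set.ncard_coe_finset, hs]
  rfl

variable [Fintype Fq]

theorem sub_pow_card_eq_C_coeff_one_mul_expPoly {s : Finset C} (h0 : 0 ∈ s) {h : C[X]}
    (hdeg : Fintype.card Fq * h.natDegree ≤ s.card)
    (hval : ∀ x ∈ s, ∃ a : Fq, h.eval x = algebraMap Fq C a) :
    h - h ^ Fintype.card Fq = Polynomial.C (h.coeff 1) * expPoly s := by
  have hcoeff : (h - h ^ Fintype.card Fq).coeff 1 = h.coeff 1 := by
    rw [coeff_sub, coeff_one_pow_card, sub_zero]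
  rw [← hcoeff]
  refine eq_C_coeff_one_mul_expPoly h0 ?_ fun x hx => ?_
  · refine (natDegree_sub_le _ _).trans (max_le (le_trans ?_ hdeg) ?_)
    · exact Nat.le_mul_of_pos_left _ Fintype.card_pos
    · rwa [natDegree_pow]
  · obtain ⟨a, ha⟩ := hval x hx
    rw [eval_sub, eval_pow, ha, ← map_pow, FiniteField.pow_card, sub_self]

theorem card_eq_card_mul_card_ker {V : Submodule Fq C} {s t : Finset C} (hs : (s : Set C) = V)
    {f : V →ₗ[Fq] Fq} (hf : f ≠ 0) (ht : (t : Set C) = (LinearMap.ker f).map V.subtype) :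
    s.card = Fintype.card Fq * t.card := by
  rw [← natCard_eq_card hs, ← natCard_eq_card ht,
    ← Nat.card_congr ((LinearMap.ker f).equivMapOfInjective _ V.injective_subtype).toEquiv,
    Submodule.card_eq_card_quotient_mul_card (LinearMap.ker f), mul_comm,
    Nat.card_congr (f.quotKerEquivOfSurjective (LinearMap.surjective hf)).toEquiv,
    Nat.card_eq_fintype_card]

theorem exists_interpolation_of_expPoly_ker_mem {V : Submodule Fq C} {s t : Finset C}
    (hs : (s : Set C) = V) {f : V →ₗ[Fq] Fq} (hf : f ≠ 0)
    (ht : (t : Set C) = (LinearMap.ker f).map V.subtype) (hlin : expPoly t ∈ linearized Fq C) :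
    ∃ h ∈ linearized Fq C, Fintype.card Fq * h.natDegree = s.card ∧
      ∀ l : V, h.eval (l : C) = algebraMap Fq C (f l) := by
  have ht0 := zero_mem_of_coe_eq ht
  have hmem (l : V) : (l : C) ∈ t ↔ f l = 0 := by
    rw [← Finset.mem_coe, ht]
    simp
  obtain ⟨v, hv⟩ := LinearMap.surjective hf 1
  have hEv : (expPoly t).eval (v : C) ≠ 0 := by
    rw [Ne, eval_expPoly_eq_zero_iff ht0, hmem, hv]
    exact one_ne_zero
  refine ⟨_, Submodule.smul_mem _ ((expPoly t).eval (v : C))⁻¹ hlin, ?_, fun l => ?_⟩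
  · rw [natDegree_smul _ (inv_ne_zero hEv), natDegree_expPoly ht0,
      card_eq_card_mul_card_ker hs hf ht]
  · have hker : (expPoly t).eval ((l - f l • v : V) : C) = 0 := by
      rw [eval_expPoly_eq_zero_iff ht0, hmem, map_sub, map_smul, hv, smul_eq_mul, mul_one, sub_self]
    have heval := isLinearMap_eval_of_mem_linearized hlin
    rw [V.coe_sub, V.coe_smul, heval.map_sub, heval.map_smul, sub_eq_zero] at hker
    rw [eval_smul, hker, smul_eq_mul, mul_smul_comm, inv_mul_cancel₀ hEv,
      Algebra.algebraMap_eq_smul_one]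

theorem expPoly_mem_linearized {V : Submodule Fq C} {s : Finset C} (hs : (s : Set C) = V) :
    expPoly s ∈ linearized Fq C := by
  induction hn : s.card using Nat.strong_induction_on generalizing s V with
  | _ n ih =>
  by_cases hV : V = ⊥
  · have : s = {0} := by
      rw [← Finset.coe_inj, hs, hV, Submodule.bot_coe, Finset.coe_singleton]
    rw [this, expPoly, Finset.prod_singleton, inv_zero, map_zero, zero_mul, sub_zero, mul_one]
    exact X_mem_linearized
  obtain ⟨v, hvV, hv⟩ := V.ne_bot_iff.1 hV
  obtain ⟨f, hf⟩ : ∃ f : Module.Dual Fq V, f ⟨v, hvV⟩ ≠ 0 := by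
    by_contra! hall
    exact hv (congrArg Subtype.val ((Module.forall_dual_apply_eq_zero_iff Fq _).1 hall))
  have hf0 : f ≠ 0 := fun h => hf (by rw [h, LinearMap.zero_apply])
  have hker : (((LinearMap.ker f).map V.subtype : Submodule Fq C) : Set C).Finite :=
    s.finite_toSet.subset (hs ▸ Submodule.map_subtype_le V _)
  have ht := hker.coe_toFinset
  have hcard := card_eq_card_mul_card_ker hs hf0 ht
  have hpos : 0 < hker.toFinset.card := Finset.card_pos.2 ⟨0, zero_mem_of_coe_eq ht⟩
  have hq := Fintype.one_lt_card (α := Fq)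
  obtain ⟨h, hh, hdeg, hval⟩ := exists_interpolation_of_expPoly_ker_mem hs hf0 ht
    (ih _ (by nlinarith) ht rfl)
  have hsub := sub_pow_card_eq_C_coeff_one_mul_expPoly (zero_mem_of_coe_eq hs) hdeg.le
    fun x hx => ⟨_, hval ⟨x, hs.subset hx⟩⟩
  have hcoeff : h.coeff 1 ≠ 0 := by
    intro h1
    rw [h1, map_zero, zero_mul, sub_eq_zero] at hsub
    have := congrArg natDegree hsub
    rw [natDegree_pow] at this
    nlinarith
  rw [← smul_eq_C_mul] at hsub
  rw [← inv_smul_smul₀ hcoeff (expPoly s), ← hsub]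
  exact Submodule.smul_mem _ _ (sub_mem hh (pow_card_mem_linearized hh))

theorem exists_linearized_interpolation {V : Submodule Fq C} {s : Finset C}
    (hs : (s : Set C) = V) (f : V →ₗ[Fq] Fq) :
    ∃ h ∈ linearized Fq C, Fintype.card Fq * h.natDegree ≤ s.card ∧
      ∀ l : V, h.eval (l : C) = algebraMap Fq C (f l) := by
  by_cases hf : f = 0
  · exact ⟨0, zero_mem _, by simp, by simp [hf]⟩
  have hker : (((LinearMap.ker f).map V.subtype : Submodule Fq C) : Set C).Finite :=
    s.finite_toSet.subset (hs ▸ Submodule.map_subtype_le V _)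
  obtain ⟨h, hh, hdeg, hval⟩ := exists_interpolation_of_expPoly_ker_mem hs hf hker.coe_toFinset
    (expPoly_mem_linearized hker.coe_toFinset)
  exact ⟨h, hh, hdeg.le, hval⟩

end Interpolation

section FiniteSubgroup

variable {C : Type*} [Field C]

theorem prod_erase_sub_eq_prod_erase_zero_neg [DecidableEq C] {G : AddSubgroup C}
    {s : Finset C} (hs : (s : Set C) = G) {l : C} (hl : l ∈ s) :
    ∏ m ∈ s.erase l, (l - m) = ∏ m ∈ s.erase 0, -m := by
  have hmem (x : C) : x ∈ s ↔ x ∈ G := by rw [← Finset.mem_coe, hs, SetLike.mem_coe]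
  have hlG := (hmem l).1 hl
  refine Finset.prod_nbij' (· - l) (· + l) ?_ ?_ ?_ ?_ ?_
  · intro m hm
    rw [Finset.mem_erase, hmem] at hm ⊢
    exact ⟨sub_ne_zero.2 hm.1, G.sub_mem hm.2 hlG⟩
  · intro m hm
    rw [Finset.mem_erase, hmem] at hm ⊢
    exact ⟨fun h => hm.1 (add_eq_right.1 h), G.add_mem hm.2 hlG⟩
  · exact fun m _ => sub_add_cancel m l
  · exact fun m _ => add_sub_cancel_right m l
  · exact fun m _ => (neg_sub m l).symm

theorem sum_eval_eq_zero_of_degree_lt {G : AddSubgroup C} {s : Finset C} (hs : (s : Set C) = G)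
    {P : C[X]} (hdeg : P.degree < (s.card - 1 : ℕ)) : ∑ l ∈ s, P.eval l = 0 := by
  classical
  have hsum := Lagrange.coeff_eq_sum (s := s) (v := id) Function.injective_id.injOn
    (hdeg.trans_le (by exact_mod_cast Nat.sub_le _ _))
  simp only [id] at hsum
  rwa [coeff_eq_zero_of_degree_lt hdeg, Finset.sum_congr rfl fun l hl => by
      rw [prod_erase_sub_eq_prod_erase_zero_neg hs hl], ← Finset.sum_div, eq_comm,
    div_eq_zero_iff, or_iff_left (prod_erase_zero_neg_ne_zero s)] at hsum

theorem coeff_one_eq_neg_sum_eval_div [DecidableEq C] {G : AddSubgroup C} {s : Finset C}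
    (hs : (s : Set C) = G) {h : C[X]} (hdeg : h.natDegree < s.card) (hh0 : h.eval 0 = 0) :
    h.coeff 1 = -∑ l ∈ s.erase 0, h.eval l / l := by
  have h0 : 0 ∈ s := by
    rw [← Finset.mem_coe, hs]
    exact G.zero_mem
  have heval (l : C) : h.eval l = h.divX.eval l * l := by
    conv_lhs => rw [← divX_mul_X_add h, coeff_zero_eq_eval_zero, hh0, map_zero, add_zero]
    rw [eval_mul, eval_X]
  have hdiv : h.divX.degree < (s.card - 1 : ℕ) := (degree_lt_iff_coeff_zero _ _).2 fun m hm => by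
    rw [coeff_divX]
    exact coeff_eq_zero_of_natDegree_lt (by omega)
  have hsum := sum_eval_eq_zero_of_degree_lt hs hdiv
  rw [← Finset.add_sum_erase s _ h0, ← coeff_zero_eq_eval_zero, coeff_divX, zero_add] at hsum
  rw [eq_neg_iff_add_eq_zero, Finset.sum_congr rfl fun l hl => by
    rw [heval, mul_div_cancel_right₀ _ (Finset.ne_of_mem_erase hl)], hsum]

end FiniteSubgroup

/-! ## Growth and a Schwarz lemma -/

section Growth

variable {C : Type*} [NormedField C]

/-- The maximum of the exponential of `s` on the disk of radius `r`, as read off its Newton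
polygon: only the roots in the disk contribute a factor. As `r / ‖0‖ = 0`, the root `0` of `s`
contributes the factor `1`. -/
def growth (s : Finset C) (r : ℝ) : ℝ := r * ∏ l ∈ s, max 1 (r / ‖l‖)

theorem le_growth (s : Finset C) {r : ℝ} (hr : 0 ≤ r) : r ≤ growth s r :=
  le_mul_of_one_le_right hr (Finset.one_le_prod fun _ _ => le_max_left _ _)

theorem growth_erase_zero [DecidableEq C] (s : Finset C) (r : ℝ) :
    growth (s.erase 0) r = growth s r := by
  rw [growth, Finset.prod_erase s (by simp), growth]

theorem growth_le_growth {s t : Finset C} {r : ℝ} (hr : 0 ≤ r)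
    (hst : ∀ l ∈ s, ‖l‖ < r → l ∈ t) : growth s r ≤ growth t r := by
  classical
  refine mul_le_mul_of_nonneg_left ?_ hr
  rw [← Finset.prod_filter_mul_prod_filter_not s (· ∈ t),
    Finset.prod_eq_one (s := s.filter (· ∉ t)), mul_one]
  · exact Finset.prod_le_prod_of_subset_of_one_le (fun l hl => (Finset.mem_filter.1 hl).2)
      (fun _ _ => by positivity) fun _ _ _ => le_max_left _ _
  · intro l hl
    rw [Finset.mem_filter] at hl
    exact max_eq_left (div_le_one_of_le₀ (not_lt.1 (mt (hst l hl.1) hl.2)) (norm_nonneg l))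

theorem hasSum_zero_of_eq_one_sub_div_mul [CompleteSpace C] {a b : ℕ → C} {l x : C} {r B : ℝ}
    (hl0 : l ≠ 0) (hxl : x ≠ l) (hx : ‖x‖ < r) (hb : ∀ k, ‖b k‖ * r ^ k ≤ B) (h0 : b 0 = a 0)
    (hab : ∀ k, b (k + 1) - b k / l = a (k + 1)) (hax : HasSum (fun k => a k * x ^ k) 0) :
    HasSum (fun k => b k * x ^ k) 0 := by
  have hr : 0 < r := (norm_nonneg x).trans_lt hx
  have hsum : Summable fun k => b k * x ^ k := by
    refine .of_norm_bounded ((summable_geometric_of_lt_one (by positivity)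
      ((div_lt_one hr).2 hx)).mul_left B) fun k => ?_
    rw [norm_mul, norm_pow, div_pow, mul_div_left_comm, mul_comm]
    gcongr
    rw [le_div_iff₀ (by positivity)]
    exact hb k
  have hmul : HasSum (fun k => a k * x ^ k) ((1 - x / l) * ∑' k, b k * x ^ k) := by
    have hshift := (hasSum_nat_add_iff' 1).2 hsum.hasSum
    rw [← hasSum_nat_add_iff' 1]
    convert hshift.sub (hsum.hasSum.mul_left (x / l)) using 1
    · funext k
      rw [← hab]
      ring
    · simp only [Finset.sum_range_one, h0]
      ring
  have hne : 1 - x / l ≠ 0 := fun h => hxl ((div_eq_one_iff_eq hl0).1 (sub_eq_zero.1 h).symm)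
  rw [← (mul_eq_zero_iff_left hne).1 (hmul.unique hax)]
  exact hsum.hasSum

variable [IsUltrametricDist C]

theorem norm_coeff_mul_one_sub_le {P : C[X]} {r A : ℝ} (hr : 0 ≤ r)
    (hP : ∀ j, ‖P.coeff j‖ * r ^ j ≤ A) (c : C) (j : ℕ) :
    ‖(P * (1 - Polynomial.C c * X)).coeff j‖ * r ^ j ≤ A * max 1 (‖c‖ * r) := by
  have hA : 0 ≤ A := (by positivity : 0 ≤ ‖P.coeff 0‖ * r ^ 0).trans (hP 0)
  have h1 := (hP j).trans (le_mul_of_one_le_right hA (le_max_left 1 (‖c‖ * r)))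
  have hmul : P * (1 - Polynomial.C c * X) = P + Polynomial.C (-c) * (P * X) := by
    rw [map_neg]
    ring
  rw [hmul, coeff_add, coeff_C_mul]
  cases j with
  | zero => rwa [mul_coeff_zero, coeff_X_zero, mul_zero, mul_zero, add_zero]
  | succ j =>
    rw [coeff_mul_X]
    refine (mul_le_mul_of_nonneg_right (IsUltrametricDist.norm_add_le_max _ _)
      (by positivity)).trans ?_
    rw [max_mul_of_nonneg _ _ (by positivity)]
    refine max_le h1 ?_
    calc ‖-c * P.coeff j‖ * r ^ (j + 1) = ‖P.coeff j‖ * r ^ j * (‖c‖ * r) := by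
          rw [norm_mul, norm_neg]
          ring
      _ ≤ A * max 1 (‖c‖ * r) := by
          gcongr
          · exact hP j
          · exact le_max_right _ _

theorem norm_coeff_expPoly_le {r : ℝ} (hr : 0 ≤ r) (s : Finset C) (j : ℕ) :
    ‖(expPoly s).coeff j‖ * r ^ j ≤ growth s r := by
  classical
  rw [expPoly, growth]
  induction s using Finset.induction_on generalizing j with
  | empty =>
    rw [Finset.prod_empty, Finset.prod_empty, mul_one, mul_one, coeff_X]
    split_ifs with h
    · simp [← h]
    · simpa using hr
  | insert l t hl ih =>
    rw [Finset.prod_insert hl, Finset.prod_insert hl, mul_comm (1 - _), ← mul_assoc,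
      mul_comm (max _ _), ← mul_assoc, div_eq_inv_mul, ← norm_inv]
    exact norm_coeff_mul_one_sub_le hr ih _ j

theorem norm_sum_range_mul_pow_le {a : ℕ → C} {l : C} {r B : ℝ} (hl : ‖l‖ < r)
    (ha : ∀ k, ‖a k‖ * r ^ k ≤ B) (hal : HasSum (fun k => a k * l ^ k) 0) (k : ℕ) :
    ‖∑ i ∈ Finset.range k, a i * l ^ i‖ ≤ B * (‖l‖ / r) ^ k := by
  have hr : 0 < r := (norm_nonneg l).trans_lt hl
  have hB : 0 ≤ B := (by positivity : 0 ≤ ‖a 0‖ * r ^ 0).trans (ha 0)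
  have htail := (hasSum_nat_add_iff' k).2 hal
  rw [zero_sub] at htail
  rw [← norm_neg, ← htail.tsum_eq]
  refine IsUltrametricDist.norm_tsum_le_of_forall_le_of_nonneg (by positivity) fun i => ?_
  calc ‖a (i + k) * l ^ (i + k)‖ = ‖a (i + k)‖ * r ^ (i + k) * (‖l‖ / r) ^ (i + k) := by
        rw [norm_mul, norm_pow, div_pow]
        field_simp
    _ ≤ B * (‖l‖ / r) ^ k := by
        have hle : ‖l‖ / r ≤ 1 := div_le_one_of_le₀ hl.le hr.le
        exact mul_le_mul (ha _)
          (pow_le_pow_of_le_one (by positivity) hle (Nat.le_add_left k i)) (by positivity) hB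

theorem exists_eq_one_sub_div_mul {a : ℕ → C} {l : C} {r B : ℝ} (hl0 : l ≠ 0) (hl : ‖l‖ < r)
    (ha : ∀ k, ‖a k‖ * r ^ k ≤ B) (hal : HasSum (fun k => a k * l ^ k) 0) :
    ∃ b : ℕ → C, b 0 = a 0 ∧ (∀ k, b (k + 1) - b k / l = a (k + 1)) ∧
      ∀ k, ‖b k‖ * r ^ k ≤ B * (‖l‖ / r) := by
  have hr : 0 < r := (norm_nonneg l).trans_lt hl
  refine ⟨fun k => (∑ i ∈ Finset.range (k + 1), a i * l ^ i) / l ^ k, by simp, fun k => ?_,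
    fun k => ?_⟩
  · simp only [Finset.sum_range_succ _ (k + 1)]
    field_simp
    ring
  · have : 0 < ‖l‖ := norm_pos_iff.2 hl0
    calc ‖(∑ i ∈ Finset.range (k + 1), a i * l ^ i) / l ^ k‖ * r ^ k
        ≤ B * (‖l‖ / r) ^ (k + 1) / ‖l‖ ^ k * r ^ k := by
          rw [norm_div, norm_pow]
          gcongr
          exact norm_sum_range_mul_pow_le hl ha hal (k + 1)
      _ = B * (‖l‖ / r) := by
          rw [pow_succ, div_pow]
          field_simp

theorem norm_zero_mul_prod_max_le_of_hasSum_zero [CompleteSpace C] {a : ℕ → C} {r B : ℝ}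
    (hr : 0 ≤ r) (ha : ∀ k, ‖a k‖ * r ^ k ≤ B) (s : Finset C)
    (hs : ∀ l ∈ s, ‖l‖ < r → HasSum (fun k => a k * l ^ k) 0) :
    ‖a 0‖ * ∏ l ∈ s, max 1 (r / ‖l‖) ≤ B := by
  classical
  induction s using Finset.induction_on generalizing a B with
  | empty => simpa using ha 0
  | insert l s hls ih =>
    rw [Finset.prod_insert hls]
    rcases le_or_gt (r / ‖l‖) 1 with h | h
    · rw [max_eq_left h, one_mul]
      exact ih ha fun m hm => hs m (Finset.mem_insert_of_mem hm)
    have hl0 : l ≠ 0 := by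
      rintro rfl
      simp [zero_lt_one.not_gt] at h
    have hl' : 0 < ‖l‖ := norm_pos_iff.2 hl0
    have hl : ‖l‖ < r := (one_lt_div hl').1 h
    obtain ⟨b, hb0, hab, hb⟩ := exists_eq_one_sub_div_mul hl0 hl ha
      (hs l (Finset.mem_insert_self l s) hl)
    have hbs := ih hb fun m hm hmr => hasSum_zero_of_eq_one_sub_div_mul hl0
      (ne_of_mem_of_not_mem hm hls) hmr hb hb0 hab (hs m (Finset.mem_insert_of_mem hm) hmr)
    rw [max_eq_right h.le, mul_left_comm, ← hb0, div_mul_eq_mul_div, div_le_iff₀ hl']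
    calc r * (‖b 0‖ * ∏ m ∈ s, max 1 (r / ‖m‖)) ≤ r * (B * (‖l‖ / r)) := by gcongr
      _ = B * ‖l‖ := by
        have := (hl'.trans hl).ne'
        field_simp

end Growth

/-! ## Entire series -/

section Entire

/-- The series `∑ aₙ x ^ (q ^ n)` is entire: its terms are bounded on each disk. -/
def IsEntire {C : Type*} [Norm C] (q : ℕ) (a : ℕ → C) : Prop :=
  ∀ r : ℝ, 0 < r → ∃ B, ∀ n, ‖a n‖ * r ^ q ^ n ≤ B

theorem pow_le_max_one_of_pow_le_max {u : ℕ → ℝ} {q : ℕ} (hq : 1 < q) {A B : ℝ}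
    (hu0 : ∀ n, 0 ≤ u n) (hB : ∀ n, u n ≤ B) (hu : ∀ n, u n ^ q ≤ max A (u (n + 1))) (n : ℕ) :
    u n ^ q ≤ max 1 A := by
  by_contra! h
  obtain ⟨h1, hA⟩ := max_lt_iff.1 h
  have hn : 1 < u n := lt_of_not_ge fun h' => h1.not_ge (pow_le_one₀ (hu0 n) h')
  have hgrow (k : ℕ) : u n ^ q ^ k ≤ u (n + k) := by
    induction k with
    | zero => simp
    | succ k ih =>
      have hstep : u n ^ q ^ (k + 1) ≤ max A (u (n + k + 1)) := by
        rw [pow_succ, pow_mul]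
        exact (pow_le_pow_left₀ (by positivity) ih q).trans (hu (n + k))
      have hlt : A < u n ^ q ^ (k + 1) :=
        hA.trans_le (pow_le_pow_right₀ hn.le (Nat.le_self_pow k.succ_ne_zero q))
      exact (le_max_iff.1 hstep).resolve_left hlt.not_ge
  obtain ⟨k, hk⟩ := pow_unbounded_of_one_lt B hn
  exact (hk.trans_le (pow_le_pow_right₀ hn.le (Nat.lt_pow_self hq).le)).not_ge
    ((hgrow k).trans (hB _))

variable {C : Type*} [NormedField C]

theorem norm_mul_pow_pow_le {q : ℕ} (hq : 1 < q) {a x : C} {r B : ℝ} (hxr : ‖x‖ < r) {n : ℕ}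
    (ha : ‖a‖ * r ^ q ^ n ≤ B) : ‖a * x ^ q ^ n‖ ≤ B * (‖x‖ / r) ^ n := by
  have hr : 0 < r := (norm_nonneg x).trans_lt hxr
  calc ‖a * x ^ q ^ n‖ = ‖a‖ * r ^ q ^ n * (‖x‖ / r) ^ q ^ n := by
        rw [norm_mul, norm_pow, div_pow]
        field_simp
    _ ≤ B * (‖x‖ / r) ^ n :=
      mul_le_mul ha (pow_le_pow_of_le_one (by positivity) ((div_le_one hr).2 hxr.le)
        (Nat.lt_pow_self hq).le) (by positivity) ((by positivity : 0 ≤ ‖a‖ * r ^ q ^ n).trans ha)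

theorem summable_mul_norm_div_pow {x : C} {r : ℝ} (hxr : ‖x‖ < r) (B : ℝ) :
    Summable fun n : ℕ => B * (‖x‖ / r) ^ n := by
  have hr : 0 < r := (norm_nonneg x).trans_lt hxr
  exact (summable_geometric_of_lt_one (by positivity) ((div_lt_one hr).2 hxr)).mul_left B

theorem IsEntire.summable [CompleteSpace C] {q : ℕ} {a : ℕ → C} (ha : IsEntire q a) (hq : 1 < q)
    (x : C) : Summable fun n => a n * x ^ q ^ n := by
  obtain ⟨B, hB⟩ := ha (‖x‖ + 1) (by positivity)
  exact .of_norm_bounded (summable_mul_norm_div_pow (lt_add_one ‖x‖) B) fun n =>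
    norm_mul_pow_pow_le hq (lt_add_one ‖x‖) (hB n)

theorem IsEntire.sub {q : ℕ} {a b : ℕ → C} (ha : IsEntire q a)
    (hb : IsEntire q b) : IsEntire q (a - b) := by
  intro r hr
  obtain ⟨A, hA⟩ := ha r hr
  obtain ⟨B, hB⟩ := hb r hr
  refine ⟨A + B, fun n => ?_⟩
  calc ‖a n - b n‖ * r ^ q ^ n ≤ (‖a n‖ + ‖b n‖) * r ^ q ^ n := by
        gcongr
        exact norm_sub_le _ _
    _ ≤ A + B := by
        rw [add_mul]
        exact add_le_add (hA n) (hB n)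

theorem norm_mul_le_of_tendsto {a : ℕ → C} {b : C} {B c : ℝ} (hab : Tendsto a atTop (𝓝 b))
    (ha : ∀ m, ‖a m‖ * c ≤ B) : ‖b‖ * c ≤ B :=
  le_of_tendsto (hab.norm.mul_const c) (Eventually.of_forall ha)

theorem isEntire_of_tendsto {q : ℕ} {a : ℕ → ℕ → C} {b : ℕ → C}
    (hab : ∀ n, Tendsto (fun m => a m n) atTop (𝓝 (b n)))
    (ha : ∀ r : ℝ, 0 < r → ∃ B, ∀ m n, ‖a m n‖ * r ^ q ^ n ≤ B) : IsEntire q b := fun r hr =>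
  (ha r hr).imp fun _ hB n => norm_mul_le_of_tendsto (hab n) fun m => hB m n

theorem hasSum_of_tendsto_coeff [CompleteSpace C] {Fq : Type*} [Fintype Fq] [Nontrivial Fq]
    {P : ℕ → C[X]} (hP : ∀ m, P m ∈ linearized Fq C) {b : ℕ → C}
    (hPb : ∀ n, Tendsto (fun m => (P m).coeff (Fintype.card Fq ^ n)) atTop (𝓝 (b n)))
    (hbound : ∀ r : ℝ, 0 < r → ∃ B, ∀ m n,
      ‖(P m).coeff (Fintype.card Fq ^ n)‖ * r ^ Fintype.card Fq ^ n ≤ B)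
    {x y : C} (hy : ∀ᶠ m in atTop, (P m).eval x = y) :
    HasSum (fun n => b n * x ^ Fintype.card Fq ^ n) y := by
  have hq : 1 < Fintype.card Fq := Fintype.one_lt_card
  obtain ⟨B, hB⟩ := hbound (‖x‖ + 1) (by positivity)
  have hlim := tendsto_tsum_of_dominated_convergence
    (summable_mul_norm_div_pow (lt_add_one ‖x‖) B) (fun n => (hPb n).mul_const _)
    (Eventually.of_forall fun m n => norm_mul_pow_pow_le hq (lt_add_one ‖x‖) (hB m n))
  have heval (m : ℕ) := (hasSum_eval_of_mem_linearized (hP m) x).tsum_eq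
  simp only [heval] at hlim
  rw [tendsto_nhds_unique (tendsto_const_nhds.congr' (hy.mono fun m hm => hm.symm)) hlim]
  exact ((isEntire_of_tendsto hPb hbound).summable hq x).hasSum

theorem exists_norm_coeff_mul_pow_le (P : C[X]) {r : ℝ} (hr : 0 ≤ r) :
    ∃ B, ∀ k, ‖P.coeff k‖ * r ^ k ≤ B := by
  refine ⟨∑ j ∈ P.support, ‖P.coeff j‖ * r ^ j, fun k => ?_⟩
  by_cases hk : k ∈ P.support
  · exact Finset.single_le_sum (f := fun j => ‖P.coeff j‖ * r ^ j)
      (fun _ _ => by positivity) hk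
  · rw [notMem_support_iff.1 hk, norm_zero, zero_mul]
    positivity

theorem norm_zero_mul_growth_le [IsUltrametricDist C] [CompleteSpace C] {q : ℕ} (hq : 1 < q)
    {a : ℕ → C} {r B : ℝ} (hr : 0 < r) (ha : ∀ n, ‖a n‖ * r ^ q ^ n ≤ B) {s : Finset C}
    (hs : ∀ l ∈ s, HasSum (fun n => a n * l ^ q ^ n) 0) : ‖a 0‖ * growth s r ≤ B := by
  classical
  have hq0 (n : ℕ) : q ^ n - 1 + 1 = q ^ n := Nat.sub_add_cancel (Nat.pow_pos (by omega))
  have hinj : Function.Injective fun n => q ^ n - 1 := fun m n hmn =>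
    Nat.pow_right_injective hq ((hq0 m).symm.trans ((congrArg (· + 1) hmn).trans (hq0 n)))
  -- The coefficients of `∑ aₙ x ^ (q ^ n - 1)`, from which the root at `0` has been removed.
  set c : ℕ → C := Function.extend (fun n => q ^ n - 1) a 0
  have hc (n : ℕ) : c (q ^ n - 1) = a n := hinj.extend_apply a 0 n
  have hc0 (k : ℕ) (hk : k ∉ Set.range fun n => q ^ n - 1) : c k = 0 :=
    Function.extend_apply' _ _ _ hk
  have hbound (k : ℕ) : ‖c k‖ * r ^ k ≤ B / r := by
    rw [le_div_iff₀ hr, mul_assoc, ← pow_succ]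
    by_cases hk : k ∈ Set.range fun n => q ^ n - 1
    · obtain ⟨n, rfl⟩ := hk
      simpa only [hc, hq0] using ha n
    · rw [hc0 k hk, norm_zero, zero_mul]
      exact (by positivity : 0 ≤ ‖a 0‖ * r ^ q ^ 0).trans (ha 0)
  have hroot (l : C) (hl : l ∈ s.erase 0) : HasSum (fun k => c k * l ^ k) 0 := by
    rw [Finset.mem_erase] at hl
    rw [← hinj.hasSum_iff fun k hk => by rw [hc0 k hk, zero_mul]]
    have := (hs l hl.2).div_const l
    rw [zero_div] at this
    refine this.congr_fun fun n => ?_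
    rw [Function.comp_apply, hc, ← mul_div_cancel_right₀ (l ^ (q ^ n - 1)) hl.1, ← pow_succ, hq0,
      mul_div_assoc]
  have hschwarz := norm_zero_mul_prod_max_le_of_hasSum_zero hr.le hbound (s.erase 0)
    fun l hl _ => hroot l hl
  rw [le_div_iff₀ hr, mul_assoc, mul_comm _ r, show c 0 = a 0 from hc 0] at hschwarz
  rwa [← growth_erase_zero]

end Entire

theorem norm_algebraMap_le_one {Fq C : Type*} [Field Fq] [Finite Fq] [NormedField C] [Algebra Fq C]
    (a : Fq) : ‖algebraMap Fq C a‖ ≤ 1 := by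
  have := Fintype.ofFinite Fq
  have h : ‖algebraMap Fq C a‖ ^ Fintype.card Fq = ‖algebraMap Fq C a‖ := by
    rw [← norm_pow, ← map_pow, FiniteField.pow_card]
  by_contra! h1
  exact (lt_self_pow₀ h1 Fintype.one_lt_card).ne' h

/-! ## Poonen's series -/

section Poonen

variable (Fq : Type*) {C : Type*} [Fintype Fq]

/-- The coefficients of the series `g` with `β ∑ eᵢ τⁱ = (1 - τ) g`. -/
def poonenCoeff [CommRing C] (e : ℕ → C) (β : C) : ℕ → C
  | 0 => β * e 0
  | n + 1 => β * e (n + 1) + poonenCoeff e β n ^ Fintype.card Fq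

variable {Fq}

theorem tendsto_poonenCoeff [CommRing C] [TopologicalSpace C] [IsTopologicalRing C] {α : Type*}
    {F : Filter α} {e : α → ℕ → C} {e' : ℕ → C} {β : α → C} {β' : C}
    (he : ∀ n, Tendsto (fun m => e m n) F (𝓝 (e' n))) (hβ : Tendsto β F (𝓝 β')) (n : ℕ) :
    Tendsto (fun m => poonenCoeff Fq (e m) (β m) n) F (𝓝 (poonenCoeff Fq e' β' n)) := by
  induction n with
  | zero => exact hβ.mul (he 0)
  | succ n ih => exact (hβ.mul (he (n + 1))).add (ih.pow _)

section Bound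

variable [Nontrivial Fq] [NormedField C] [IsUltrametricDist C]

theorem norm_poonenCoeff_mul_pow_pow_card_le {e : ℕ → C}
    {β : C} {r T B : ℝ} (hr : 0 ≤ r) (he : ∀ n, ‖e n‖ * r ^ Fintype.card Fq ^ n ≤ T)
    (hB : ∀ n, ‖poonenCoeff Fq e β n‖ * r ^ Fintype.card Fq ^ n ≤ B) (n : ℕ) :
    (‖poonenCoeff Fq e β n‖ * r ^ Fintype.card Fq ^ n) ^ Fintype.card Fq ≤ max 1 (‖β‖ * T) := by
  refine pow_le_max_one_of_pow_le_max
    (u := fun n => ‖poonenCoeff Fq e β n‖ * r ^ Fintype.card Fq ^ n) Fintype.one_lt_card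
    (fun n => by positivity) hB (fun n => ?_) n
  have hpow : poonenCoeff Fq e β n ^ Fintype.card Fq =
      -(β * e (n + 1)) + poonenCoeff Fq e β (n + 1) := (neg_add_cancel_left _ _).symm
  calc (‖poonenCoeff Fq e β n‖ * r ^ Fintype.card Fq ^ n) ^ Fintype.card Fq
      = ‖-(β * e (n + 1)) + poonenCoeff Fq e β (n + 1)‖ * r ^ Fintype.card Fq ^ (n + 1) := by
        rw [mul_pow, ← norm_pow, hpow, ← pow_mul, ← pow_succ]
    _ ≤ max ‖-(β * e (n + 1))‖ ‖poonenCoeff Fq e β (n + 1)‖ *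
          r ^ Fintype.card Fq ^ (n + 1) := by
        gcongr
        exact IsUltrametricDist.norm_add_le_max _ _
    _ = max (‖β‖ * (‖e (n + 1)‖ * r ^ Fintype.card Fq ^ (n + 1)))
          (‖poonenCoeff Fq e β (n + 1)‖ * r ^ Fintype.card Fq ^ (n + 1)) := by
        rw [max_mul_of_nonneg _ _ (by positivity), norm_neg, norm_mul, mul_assoc]
    _ ≤ max (‖β‖ * T) (‖poonenCoeff Fq e β (n + 1)‖ * r ^ Fintype.card Fq ^ (n + 1)) := by
        gcongr
        exact he _

theorem norm_poonenCoeff_mul_pow_le {e : ℕ → C} {β : C}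
    {r T B : ℝ} (hr : 0 ≤ r) (he : ∀ n, ‖e n‖ * r ^ Fintype.card Fq ^ n ≤ T)
    (hB : ∀ n, ‖poonenCoeff Fq e β n‖ * r ^ Fintype.card Fq ^ n ≤ B) (n : ℕ) :
    ‖poonenCoeff Fq e β n‖ * r ^ Fintype.card Fq ^ n ≤ max 1 (‖β‖ * T) := by
  rcases le_total (‖poonenCoeff Fq e β n‖ * r ^ Fintype.card Fq ^ n) 1 with h | h
  · exact h.trans (le_max_left _ _)
  · exact (le_self_pow₀ h Fintype.card_ne_zero).trans
      (norm_poonenCoeff_mul_pow_pow_card_le hr he hB n)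

/-- If `g` vanishes on `s`, then `‖β‖ * growth s r ≤ M` for the maximum `M` of `g` on the disk of
radius `r`, whereas `M ^ q ≤ max 1 (‖β‖ * growth s r)` because `β ∑ eᵢ τⁱ = (1 - τ) g`. -/
theorem norm_mul_growth_le_one [CompleteSpace C] {e : ℕ → C} {β : C}
    {s : Finset C} {r : ℝ} (hr : 0 < r) (he0 : e 0 = 1)
    (he : ∀ n, ‖e n‖ * r ^ Fintype.card Fq ^ n ≤ growth s r)
    (hβ : IsEntire (Fintype.card Fq) (poonenCoeff Fq e β))
    (hs : ∀ l ∈ s, HasSum (fun n => poonenCoeff Fq e β n * l ^ Fintype.card Fq ^ n) 0) :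
    ‖β‖ * growth s r ≤ 1 := by
  by_contra! h
  obtain ⟨B, hB⟩ := hβ r hr
  have hq := Fintype.card_ne_zero (α := Fq)
  set M : ℝ := (‖β‖ * growth s r) ^ (Fintype.card Fq : ℝ)⁻¹
  have hM : M ^ Fintype.card Fq = ‖β‖ * growth s r :=
    Real.rpow_inv_natCast_pow (zero_le_one.trans h.le) hq
  have hbound (n : ℕ) : ‖poonenCoeff Fq e β n‖ * r ^ Fintype.card Fq ^ n ≤ M := by
    have hpow := norm_poonenCoeff_mul_pow_pow_card_le hr.le he hB n
    rw [max_eq_right h.le, ← hM] at hpow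
    exact (pow_le_pow_iff_left₀ (by positivity)
      (Real.rpow_nonneg (zero_le_one.trans h.le) _) hq).1 hpow
  have hschwarz := norm_zero_mul_growth_le Fintype.one_lt_card hr hbound hs
  rw [poonenCoeff, he0, mul_one] at hschwarz
  have hlt := lt_self_pow₀ h (Fintype.one_lt_card (α := Fq))
  have hle := pow_le_pow_left₀ (zero_le_one.trans h.le) hschwarz (Fintype.card Fq)
  exact (hlt.trans_le hle).ne hM.symm

end Bound

variable [Field Fq]

theorem poonenCoeff_sub [CommRing C] [Algebra Fq C] (e : ℕ → C) (β γ : C) :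
    poonenCoeff Fq e (β - γ) = poonenCoeff Fq e β - poonenCoeff Fq e γ := by
  funext n
  induction n with
  | zero => exact sub_mul β γ (e 0)
  | succ n ih =>
    have hpow := map_sub (FiniteField.frobeniusAlgHom Fq C) (poonenCoeff Fq e β n)
      (poonenCoeff Fq e γ n)
    simp only [FiniteField.frobeniusAlgHom_apply] at hpow
    simp only [Pi.sub_apply, poonenCoeff] at ih ⊢
    rw [ih, hpow]
    ring

theorem coeff_eq_poonenCoeff [CommRing C] [Algebra Fq C] {h E : C[X]} {β : C}
    (hE : h - h ^ Fintype.card Fq = Polynomial.C β * E) (n : ℕ) :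
    h.coeff (Fintype.card Fq ^ n) =
      poonenCoeff Fq (fun n => E.coeff (Fintype.card Fq ^ n)) β n := by
  have hcoeff (k : ℕ) : h.coeff k = β * E.coeff k + (h ^ Fintype.card Fq).coeff k := by
    rw [← coeff_C_mul, ← hE, coeff_sub, sub_add_cancel]
  induction n with
  | zero => rw [poonenCoeff, pow_zero, hcoeff, coeff_one_pow_card, add_zero]
  | succ n ih => rw [poonenCoeff, ← ih, hcoeff, pow_succ, coeff_pow_card]

variable [NormedField C] [Algebra Fq C]

theorem hasSum_of_hasSum_poonenCoeff {e : ℕ → C} {β x y : C}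
    (h : HasSum (fun n => poonenCoeff Fq e β n * x ^ Fintype.card Fq ^ n) y) :
    HasSum (fun n => β * (e n * x ^ Fintype.card Fq ^ n)) (y - y ^ Fintype.card Fq) := by
  have hpow : HasSum (fun n => (poonenCoeff Fq e β n * x ^ Fintype.card Fq ^ n) ^ Fintype.card Fq)
      (y ^ Fintype.card Fq) :=
    h.map (FiniteField.frobeniusAlgHom Fq C) (continuous_pow _)
  have hshift := (hasSum_nat_add_iff' 1).2 h
  rw [← hasSum_nat_add_iff' 1]
  convert hshift.sub hpow using 1
  · funext n
    rw [poonenCoeff, mul_pow, ← pow_mul, ← pow_succ]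
    ring
  · simp only [Finset.sum_range_one, poonenCoeff]
    ring

theorem exists_hasSum_poonenCoeff_algebraMap [CompleteSpace C] {e : ℕ → C} {β x : C}
    (hβ : IsEntire (Fintype.card Fq) (poonenCoeff Fq e β))
    (he : HasSum (fun n => e n * x ^ Fintype.card Fq ^ n) 0) :
    ∃ a : Fq, HasSum (fun n => poonenCoeff Fq e β n * x ^ Fintype.card Fq ^ n)
      (algebraMap Fq C a) := by
  have hsum := (hβ.summable Fintype.one_lt_card x).hasSum
  have hfix := (hasSum_of_hasSum_poonenCoeff hsum).unique (he.mul_left β)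
  rw [mul_zero, sub_eq_zero] at hfix
  obtain ⟨a, ha⟩ := exists_algebraMap_eq_of_pow_card_eq hfix.symm
  exact ⟨a, ha ▸ hsum⟩

theorem exists_linearMap_hasSum {L : Submodule Fq C} {a : ℕ → C}
    (h : ∀ l : L, ∃ c : Fq, HasSum (fun n => a n * (l : C) ^ Fintype.card Fq ^ n)
      (algebraMap Fq C c)) :
    ∃ f : L →ₗ[Fq] Fq, ∀ l : L, HasSum (fun n => a n * (l : C) ^ Fintype.card Fq ^ n)
      (algebraMap Fq C (f l)) := by
  simp only [← frobeniusAlgHom_pow_apply (Fq := Fq)] at h ⊢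
  choose f hf using h
  have hinj := (algebraMap Fq C).injective
  refine ⟨⟨⟨f, fun x y => hinj ((hf (x + y)).unique ?_)⟩,
    fun c x => hinj ((hf (c • x)).unique ?_)⟩, hf⟩
  · simpa only [Submodule.coe_add, map_add, mul_add] using (hf x).add (hf y)
  · simpa only [Submodule.coe_smul, map_smul, mul_smul_comm, RingHom.id_apply, smul_eq_mul,
      map_mul, ← Algebra.smul_def] using (hf x).const_smul c

end Poonen

/-! ## Strongly discrete lattices -/

section Lattice

/-- A submodule meeting every ball in a finite set. -/
def StronglyDiscrete {R E : Type*} [Semiring R] [AddCommMonoid E] [Norm E] [Module R E]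
    (L : Submodule R E) : Prop :=
  ∀ r : ℝ, {x | x ∈ L ∧ ‖x‖ ≤ r}.Finite

namespace StronglyDiscrete

section Ball

variable {R E : Type*} [Semiring R] [AddCommMonoid E] [Norm E] [Module R E] {L : Submodule R E}

/-- The elements of `L` of norm at most `r`. -/
def ball (hL : StronglyDiscrete L) (r : ℝ) : Finset E := (hL r).toFinset

theorem mem_ball (hL : StronglyDiscrete L) {r : ℝ} {x : E} :
    x ∈ hL.ball r ↔ x ∈ L ∧ ‖x‖ ≤ r :=
  (hL r).mem_toFinset

theorem eventually_mem_ball (hL : StronglyDiscrete L) {x : E} (hx : x ∈ L) :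
    ∀ᶠ m : ℕ in atTop, x ∈ hL.ball m := by
  obtain ⟨N, hN⟩ := exists_nat_ge ‖x‖
  filter_upwards [eventually_ge_atTop N] with m hm
  exact hL.mem_ball.2 ⟨hx, hN.trans (Nat.cast_le.2 hm)⟩

/-- The nonzero elements of `L`, as elements of the ambient module. -/
def nonzeroEmb (L : Submodule R E) : {l : L // l ≠ 0} ↪ E :=
  (Function.Embedding.subtype _).trans (Function.Embedding.subtype _)

/-- The nonzero elements of `L` of norm at most `r`, as elements of the type over which the
exponential and the sums `∑ f(λ) / λ` are indexed. -/
def nonzeroBall (hL : StronglyDiscrete L) (r : ℝ) : Finset {l : L // l ≠ 0} :=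
  ((hL r).preimage (nonzeroEmb L).injective.injOn).toFinset

theorem mem_nonzeroBall (hL : StronglyDiscrete L) {r : ℝ} {l : {l : L // l ≠ 0}} :
    l ∈ hL.nonzeroBall r ↔ ‖(l : E)‖ ≤ r := by
  rw [nonzeroBall, Set.Finite.mem_toFinset]
  exact and_iff_right l.1.2

theorem map_nonzeroBall [DecidableEq E] (hL : StronglyDiscrete L) (r : ℝ) :
    (hL.nonzeroBall r).map (nonzeroEmb L) = (hL.ball r).erase 0 := by
  ext x
  rw [Finset.mem_map, Finset.mem_erase, hL.mem_ball]
  constructor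
  · rintro ⟨l, hl, rfl⟩
    exact ⟨fun h => l.2 (Subtype.ext h), l.1.2, hL.mem_nonzeroBall.1 hl⟩
  · rintro ⟨h0, hx, hr⟩
    exact ⟨⟨⟨x, hx⟩, fun h => h0 (congrArg Subtype.val h)⟩, hL.mem_nonzeroBall.2 hr, rfl⟩

theorem tendsto_nonzeroBall (hL : StronglyDiscrete L) :
    Tendsto (fun m : ℕ => hL.nonzeroBall m) atTop atTop := by
  refine tendsto_atTop_finset_of_monotone (fun m n hmn l hl => ?_) fun l => ?_
  · exact hL.mem_nonzeroBall.2 ((hL.mem_nonzeroBall.1 hl).trans (Nat.cast_le.2 hmn))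
  · obtain ⟨n, hn⟩ := exists_nat_ge ‖(l : E)‖
    exact ⟨n, hL.mem_nonzeroBall.2 hn⟩

end Ball

variable {R C : Type*} [Semiring R] [NormedField C] [Module R C] {L : Submodule R C}

theorem tendsto_inv_cofinite (hL : StronglyDiscrete L) :
    Tendsto (fun l : {l : L // l ≠ 0} => (l : C)⁻¹) cofinite (𝓝 0) := by
  rw [Metric.tendsto_nhds]
  intro ε hε
  refine (hL.nonzeroBall ε⁻¹).finite_toSet.subset fun l hl => hL.mem_nonzeroBall.2 ?_
  rw [Set.mem_compl_iff, Set.mem_ofPred_eq, dist_zero_right, not_lt, norm_inv] at hl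
  have hl0 : 0 < ‖(l : C)‖ := norm_pos_iff.2 fun h => l.2 (Subtype.ext h)
  exact (le_inv_comm₀ hε hl0).1 hl

theorem summable_div [IsUltrametricDist C] [CompleteSpace C] (hL : StronglyDiscrete L)
    {f : L → C} (hf : ∀ l, ‖f l‖ ≤ 1) : Summable fun l : {l : L // l ≠ 0} => f l / (l : C) := by
  refine NonarchimedeanAddGroup.summable_of_tendsto_cofinite_zero ?_
  refine squeeze_zero_norm (fun l => ?_)
    (tendsto_zero_iff_norm_tendsto_zero.1 hL.tendsto_inv_cofinite)
  rw [norm_div, norm_inv, ← one_div]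
  gcongr
  exact hf l

theorem summable_algebraMap_div {Fq : Type*} [Field Fq] [Finite Fq] [Algebra Fq C]
    [IsUltrametricDist C] [CompleteSpace C] {L : Submodule Fq C} (hL : StronglyDiscrete L)
    (f : L → Fq) : Summable fun l : {l : L // l ≠ 0} => algebraMap Fq C (f l) / (l : C) :=
  hL.summable_div fun _ => norm_algebraMap_le_one _

end StronglyDiscrete

/-- The subspace of the elements of norm at most `r`. -/
def ballSubmodule {Fq C : Type*} [Field Fq] [Finite Fq] [NormedField C] [IsUltrametricDist C]
    [Algebra Fq C] (L : Submodule Fq C) {r : ℝ} (hr : 0 ≤ r) : Submodule Fq C where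
  carrier := {x | x ∈ L ∧ ‖x‖ ≤ r}
  add_mem' hx hy := ⟨L.add_mem hx.1 hy.1,
    (IsUltrametricDist.norm_add_le_max _ _).trans (max_le hx.2 hy.2)⟩
  zero_mem' := ⟨L.zero_mem, by rwa [norm_zero]⟩
  smul_mem' a x hx := ⟨L.smul_mem a hx.1, by
    rw [Algebra.smul_def, norm_mul]
    exact (mul_le_of_le_one_left (norm_nonneg _) (norm_algebraMap_le_one a)).trans hx.2⟩

theorem StronglyDiscrete.coe_ball {Fq C : Type*} [Field Fq] [Finite Fq] [NormedField C]
    [IsUltrametricDist C] [Algebra Fq C] {L : Submodule Fq C} (hL : StronglyDiscrete L) {r : ℝ}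
    (hr : 0 ≤ r) : (hL.ball r : Set C) = ballSubmodule L hr :=
  Set.ext fun _ => hL.mem_ball

end Lattice

/-! ## The exponential of a lattice -/

section Exponential

theorem tendsto_cofinite_ite_card_eq_prod {ι C : Type*} [NormedField C] {f : ι → C}
    (hf : Tendsto f cofinite (𝓝 0)) (d : ℕ) :
    Tendsto (fun s : Finset ι => if s.card = d then ∏ i ∈ s, f i else 0) cofinite (𝓝 0) := by
  classical
  obtain ⟨B, hB⟩ := hf.norm.bddAbove_range_of_cofinite
  set M := max 1 B
  have hM (i : ι) : ‖f i‖ ≤ M := (hB ⟨i, rfl⟩).trans (le_max_right _ _)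
  have : 0 < M := zero_lt_one.trans_le (le_max_left _ _)
  rw [Metric.tendsto_nhds]
  intro ε hε
  have hlarge : {i | ¬ ‖f i‖ < ε / M ^ d}.Finite := eventually_cofinite.1
    ((tendsto_zero_iff_norm_tendsto_zero.1 hf).eventually_lt_const (by positivity))
  refine hlarge.toFinset.powerset.finite_toSet.subset fun s hs => ?_
  rw [Set.mem_compl_iff, Set.mem_ofPred_eq, dist_zero_right, not_lt] at hs
  rw [Finset.mem_coe, Finset.mem_powerset]
  intro i hi
  rw [Set.Finite.mem_toFinset, Set.mem_ofPred_eq, not_lt, div_le_iff₀ (by positivity)]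
  have hcard : s.card = d := by
    by_contra h
    rw [if_neg h, norm_zero] at hs
    exact hs.not_gt hε
  rw [if_pos hcard, norm_prod, ← Finset.mul_prod_erase s _ hi] at hs
  refine hs.trans (mul_le_mul_of_nonneg_left ?_ (norm_nonneg _))
  calc ∏ j ∈ s.erase i, ‖f j‖ ≤ ∏ _j ∈ s.erase i, M :=
        Finset.prod_le_prod (fun j _ => norm_nonneg _) fun j _ => hM j
    _ = M ^ (s.erase i).card := Finset.prod_const M
    _ ≤ M ^ d := pow_le_pow_right₀ (le_max_left _ _) (hcard ▸ Finset.card_erase_le)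

open scoped PowerSeries.WithPiTopology in
theorem multipliable_one_add_C_mul_X {ι C : Type*} [NormedField C] [IsUltrametricDist C]
    [CompleteSpace C] {f : ι → C} (hf : Tendsto f cofinite (𝓝 0)) :
    Multipliable fun i => (1 + PowerSeries.C (f i) * PowerSeries.X : PowerSeries C) := by
  refine multipliable_one_add_of_summable_prod
    ((PowerSeries.WithPiTopology.summable_iff_summable_coeff _).2 fun d => ?_)
  refine NonarchimedeanAddGroup.summable_of_tendsto_cofinite_zero
    ((tendsto_cofinite_ite_card_eq_prod hf d).congr fun s => ?_)
  rw [Finset.prod_mul_distrib, Finset.prod_const, ← map_prod, PowerSeries.coeff_C_mul,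
    PowerSeries.coeff_X_pow, mul_ite, mul_one, mul_zero]
  exact if_congr eq_comm rfl rfl

open scoped PowerSeries.WithPiTopology in
/-- The exponential `x ∏ (1 - x / λ)` of `L`, where `λ` runs over the nonzero elements of `L`;
the infinite product is taken coefficientwise. -/
def latticeExp {R C : Type*} [Semiring R] [NormedField C] [Module R C] (L : Submodule R C) :
    PowerSeries C :=
  PowerSeries.X * ∏' l : {l : L // l ≠ 0}, (1 - PowerSeries.C (l : C)⁻¹ * PowerSeries.X)

theorem StronglyDiscrete.coe_expPoly_ball {R C : Type*} [Semiring R] [NormedField C] [Module R C]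
    {L : Submodule R C} (hL : StronglyDiscrete L) (r : ℝ) :
    (expPoly (hL.ball r) : PowerSeries C) = PowerSeries.X *
      ∏ l ∈ hL.nonzeroBall r, (1 - PowerSeries.C (l : C)⁻¹ * PowerSeries.X) := by
  classical
  rw [expPoly, ← Finset.prod_erase _ (a := 0) (by simp), ← hL.map_nonzeroBall, Finset.prod_map,
    ← coeToPowerSeries.ringHom_apply, map_mul, map_prod]
  simp only [map_sub, map_one, map_mul, coeToPowerSeries.ringHom_apply, coe_X, coe_C]
  rfl

open scoped PowerSeries.WithPiTopology in
theorem StronglyDiscrete.tendsto_coeff_expPoly {R C : Type*} [Semiring R] [NormedField C]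
    [IsUltrametricDist C] [CompleteSpace C] [Module R C] {L : Submodule R C}
    (hL : StronglyDiscrete L) (k : ℕ) :
    Tendsto (fun m : ℕ => (expPoly (hL.ball m)).coeff k) atTop
      (𝓝 (PowerSeries.coeff k (latticeExp L))) := by
  have hneg : Tendsto (fun l : {l : L // l ≠ 0} => -(l : C)⁻¹) cofinite (𝓝 0) := by
    simpa only [neg_zero] using hL.tendsto_inv_cofinite.neg
  have hprod : Multipliable fun l : {l : L // l ≠ 0} =>
      (1 - PowerSeries.C (l : C)⁻¹ * PowerSeries.X : PowerSeries C) := by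
    simpa only [map_neg, neg_mul, ← sub_eq_add_neg] using multipliable_one_add_C_mul_X hneg
  have hlim := (Tendsto.comp hprod.hasProd hL.tendsto_nonzeroBall).const_mul PowerSeries.X
  refine (((PowerSeries.WithPiTopology.continuous_coeff C k).tendsto _).comp hlim).congr
    fun m => ?_
  rw [← Polynomial.coeff_coe, hL.coe_expPoly_ball]
  rfl

theorem StronglyDiscrete.norm_coeff_expPoly_ball_le {R C : Type*} [Semiring R] [NormedField C]
    [IsUltrametricDist C] [Module R C] {L : Submodule R C} (hL : StronglyDiscrete L) {r : ℝ}
    (hr : 0 ≤ r) (m : ℝ) (j : ℕ) :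
    ‖(expPoly (hL.ball m)).coeff j‖ * r ^ j ≤ growth (hL.ball r) r :=
  (norm_coeff_expPoly_le hr _ j).trans (growth_le_growth hr fun _ hl hlr =>
    hL.mem_ball.2 ⟨(hL.mem_ball.1 hl).1, hlr.le⟩)

end Exponential

/-! ## Linear forms on a lattice -/

section Duality

variable {Fq C : Type*} [Field Fq] [Fintype Fq] [NormedField C] [Algebra Fq C]

variable (Fq) in
/-- The coefficient `eₙ` of `x ^ (q ^ n)` in the exponential of `L`. -/
def expCoeff (L : Submodule Fq C) (n : ℕ) : C :=
  PowerSeries.coeff (Fintype.card Fq ^ n) (latticeExp L)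

variable [IsUltrametricDist C] {L : Submodule Fq C}

namespace StronglyDiscrete

theorem exists_linearized_interpolation_ball (hL : StronglyDiscrete L) (f : L →ₗ[Fq] Fq) {r : ℝ}
    (hr : 0 ≤ r) : ∃ h ∈ linearized Fq C,
      h - h ^ Fintype.card Fq = Polynomial.C (h.coeff 1) * expPoly (hL.ball r) ∧
      h.coeff 1 = -∑ l ∈ hL.nonzeroBall r, algebraMap Fq C (f l) / (l : C) ∧
      ∀ l : L, (l : C) ∈ hL.ball r → h.eval (l : C) = algebraMap Fq C (f l) := by
  classical
  have hs := hL.coe_ball hr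
  obtain ⟨h, hlin, hdeg, hval⟩ := exists_linearized_interpolation hs
    (f.comp (Submodule.inclusion fun _ hx => hx.1))
  have hval' (l : L) (hl : (l : C) ∈ hL.ball r) : h.eval (l : C) = algebraMap Fq C (f l) :=
    hval ⟨l, hL.mem_ball.1 hl⟩
  have h0 := zero_mem_of_coe_eq hs
  have hdeg' : h.natDegree < (hL.ball r).card := by
    have hq := Fintype.one_lt_card (α := Fq)
    have hcard := Finset.card_pos.2 ⟨0, h0⟩
    nlinarith
  refine ⟨h, hlin, sub_pow_card_eq_C_coeff_one_mul_expPoly h0 hdeg fun x hx =>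
    ⟨_, hval' ⟨x, (hL.mem_ball.1 hx).1⟩ hx⟩, ?_, hval'⟩
  rw [coeff_one_eq_neg_sum_eval_div (G := (ballSubmodule L hr).toAddSubgroup) hs hdeg'
    ((hval' 0 h0).trans (by rw [map_zero, map_zero])), ← hL.map_nonzeroBall, Finset.sum_map]
  refine congrArg _ (Finset.sum_congr rfl fun l hl => ?_)
  exact congrArg (· / (l : C)) (hval' l (hL.mem_ball.2 ⟨l.1.2, hL.mem_nonzeroBall.1 hl⟩))

variable [CompleteSpace C]

theorem norm_expCoeff_mul_pow_le (hL : StronglyDiscrete L) {r : ℝ} (hr : 0 ≤ r) (n : ℕ) :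
    ‖expCoeff Fq L n‖ * r ^ Fintype.card Fq ^ n ≤ growth (hL.ball r) r :=
  norm_mul_le_of_tendsto (hL.tendsto_coeff_expPoly _) fun m =>
    hL.norm_coeff_expPoly_ball_le hr m _

theorem expCoeff_zero (hL : StronglyDiscrete L) : expCoeff Fq L 0 = 1 := by
  refine tendsto_nhds_unique (hL.tendsto_coeff_expPoly _) ?_
  simp only [pow_zero, coeff_one_expPoly]
  exact tendsto_const_nhds

theorem hasSum_expCoeff (hL : StronglyDiscrete L) {l : C} (hl : l ∈ L) :
    HasSum (fun n => expCoeff Fq L n * l ^ Fintype.card Fq ^ n) 0 := by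
  have hcoe (m : ℕ) := hL.coe_ball (Nat.cast_nonneg m)
  refine hasSum_of_tendsto_coeff (fun m => expPoly_mem_linearized (hcoe m))
    (fun n => hL.tendsto_coeff_expPoly _)
    (fun r hr => ⟨_, fun m n => hL.norm_coeff_expPoly_ball_le hr.le m _⟩) ?_
  filter_upwards [hL.eventually_mem_ball hl] with m hm
  exact (eval_expPoly_eq_zero_iff (zero_mem_of_coe_eq (hcoe m))).2 hm

/-- The bound is uniform because an interpolating polynomial, like an entire Poonen series, is
bounded on a disk in terms of the exponential and of its linear coefficient alone. -/
theorem exists_tendsto_poonenCoeff (hL : StronglyDiscrete L) (f : L →ₗ[Fq] Fq) {β : C}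
    (hβ : HasSum (fun l : {l : L // l ≠ 0} => algebraMap Fq C (f l) / (l : C)) (-β)) :
    ∃ h : ℕ → C[X], (∀ m, h m ∈ linearized Fq C) ∧
      (∀ n, Tendsto (fun m => (h m).coeff (Fintype.card Fq ^ n)) atTop
        (𝓝 (poonenCoeff Fq (expCoeff Fq L) β n))) ∧
      (∀ r : ℝ, 0 < r → ∃ B, ∀ m n,
        ‖(h m).coeff (Fintype.card Fq ^ n)‖ * r ^ Fintype.card Fq ^ n ≤ B) ∧
      ∀ l : L, ∀ᶠ m in atTop, (h m).eval (l : C) = algebraMap Fq C (f l) := by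
  choose h hlin hE hcoeff hval using fun m : ℕ =>
    hL.exists_linearized_interpolation_ball f (Nat.cast_nonneg m)
  have hlim : Tendsto (fun m => (h m).coeff 1) atTop (𝓝 β) := by
    simpa only [hcoeff, neg_neg, Function.comp_def] using
      (Tendsto.comp hβ hL.tendsto_nonzeroBall).neg
  have hpoonen (m : ℕ) := coeff_eq_poonenCoeff (hE m)
  refine ⟨h, hlin, fun n => ?_, fun r hr => ?_,
    fun l => (hL.eventually_mem_ball l.2).mono fun m => hval m l⟩
  · simp only [hpoonen]
    exact tendsto_poonenCoeff (fun k => hL.tendsto_coeff_expPoly _) hlim n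
  · obtain ⟨A, hA⟩ := hlim.norm.bddAbove_range
    refine ⟨max 1 (A * growth (hL.ball r) r), fun m n => ?_⟩
    obtain ⟨B, hB⟩ := exists_norm_coeff_mul_pow_le (h m) hr.le
    have hbound := norm_poonenCoeff_mul_pow_le (B := B) hr.le
      (fun k => hL.norm_coeff_expPoly_ball_le hr.le m (Fintype.card Fq ^ k))
      (fun k => hpoonen m k ▸ hB _) n
    rw [hpoonen]
    exact hbound.trans (max_le_max_left 1
      (mul_le_mul_of_nonneg_right (hA ⟨m, rfl⟩) (hr.le.trans (le_growth _ hr.le))))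

theorem isEntire_poonenCoeff (hL : StronglyDiscrete L) (f : L →ₗ[Fq] Fq) {β : C}
    (hβ : HasSum (fun l : {l : L // l ≠ 0} => algebraMap Fq C (f l) / (l : C)) (-β)) :
    IsEntire (Fintype.card Fq) (poonenCoeff Fq (expCoeff Fq L) β) := by
  obtain ⟨h, -, hlim, hbound, -⟩ := hL.exists_tendsto_poonenCoeff f hβ
  exact isEntire_of_tendsto hlim hbound

theorem hasSum_poonenCoeff (hL : StronglyDiscrete L) (f : L →ₗ[Fq] Fq) {β : C}
    (hβ : HasSum (fun l : {l : L // l ≠ 0} => algebraMap Fq C (f l) / (l : C)) (-β)) (l : L) :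
    HasSum (fun n => poonenCoeff Fq (expCoeff Fq L) β n * (l : C) ^ Fintype.card Fq ^ n)
      (algebraMap Fq C (f l)) := by
  obtain ⟨h, hlin, hlim, hbound, hval⟩ := hL.exists_tendsto_poonenCoeff f hβ
  exact hasSum_of_tendsto_coeff hlin hlim hbound (hval l)

theorem eq_zero_of_hasSum_poonenCoeff_zero (hL : StronglyDiscrete L) {β : C}
    (hβ : IsEntire (Fintype.card Fq) (poonenCoeff Fq (expCoeff Fq L) β))
    (h0 : ∀ l ∈ L, HasSum (fun n => poonenCoeff Fq (expCoeff Fq L) β n * l ^ Fintype.card Fq ^ n)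
      0) : β = 0 := by
  by_contra hne
  have hpos := norm_pos_iff.2 hne
  have hr : 0 < 2 / ‖β‖ := by positivity
  have hle := norm_mul_growth_le_one hr hL.expCoeff_zero (hL.norm_expCoeff_mul_pow_le hr.le) hβ
    fun l hl => h0 l (hL.mem_ball.1 hl).1
  have hgrowth := mul_le_mul_of_nonneg_left (le_growth (hL.ball (2 / ‖β‖)) hr.le) hpos.le
  rw [mul_div_cancel₀ _ hpos.ne'] at hgrowth
  linarith

theorem hasSum_algebraMap_div (hL : StronglyDiscrete L) {β : C}
    (hβ : IsEntire (Fintype.card Fq) (poonenCoeff Fq (expCoeff Fq L) β)) {f : L →ₗ[Fq] Fq}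
    (hf : ∀ l : L, HasSum
      (fun n => poonenCoeff Fq (expCoeff Fq L) β n * (l : C) ^ Fintype.card Fq ^ n)
      (algebraMap Fq C (f l))) :
    HasSum (fun l : {l : L // l ≠ 0} => algebraMap Fq C (f l) / (l : C)) (-β) := by
  have hγ := (hL.summable_algebraMap_div f).hasSum
  set γ := -∑' l : {l : L // l ≠ 0}, algebraMap Fq C (f l) / (l : C) with hγ_def
  rw [← neg_neg (tsum _), ← hγ_def] at hγ
  have hzero : β - γ = 0 := by
    refine hL.eq_zero_of_hasSum_poonenCoeff_zero ?_ fun l hl => ?_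
    · rw [poonenCoeff_sub]
      exact hβ.sub (hL.isEntire_poonenCoeff f hγ)
    · simpa only [poonenCoeff_sub, Pi.sub_apply, sub_mul, sub_self] using
        (hf ⟨l, hl⟩).sub (hL.hasSum_poonenCoeff f hγ ⟨l, hl⟩)
  rwa [sub_eq_zero.1 hzero]

end StronglyDiscrete

end Duality

/-! ## The dual exponential -/

section Frobenius

variable {C : Type*} [NormedField C] {σ : C ≃+* C} {q : ℕ}

theorem iterate_eq_pow_pow (hσ : ∀ x, σ x = x ^ q) (n : ℕ) (x : C) : σ^[n] x = x ^ q ^ n := by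
  rw [show ⇑σ = fun x => x ^ q from funext hσ, pow_iterate]

theorem norm_symm_iterate_pow_pow (hσ : ∀ x, σ x = x ^ q) (n : ℕ) (x : C) :
    ‖σ.symm^[n] x‖ ^ q ^ n = ‖x‖ := by
  rw [← norm_pow, ← iterate_eq_pow_pow hσ, (Function.RightInverse.iterate σ.apply_symm_apply n) x]

theorem isEntire_iff_tendsto_symm_iterate (hσ : ∀ x, σ x = x ^ q) (hq : 1 < q) {a : ℕ → C} :
    IsEntire q a ↔ Tendsto (fun n => σ.symm^[n] (a n)) atTop (𝓝 0) := by
  have hnorm (r : ℝ) (n : ℕ) : ‖a n‖ * r ^ q ^ n = (‖σ.symm^[n] (a n)‖ * r) ^ q ^ n := by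
    rw [mul_pow, norm_symm_iterate_pow_pow hσ]
  simp only [IsEntire, hnorm]
  refine ⟨fun h => Metric.tendsto_nhds.2 fun ε hε => ?_, fun h r hr => ?_⟩
  · obtain ⟨B, hB⟩ := h (2 / ε) (by positivity)
    filter_upwards [(tendsto_pow_atTop_atTop_of_one_lt one_lt_two).eventually_gt_atTop B] with n hn
    have hlt : (‖σ.symm^[n] (a n)‖ * (2 / ε)) ^ q ^ n < 2 ^ q ^ n :=
      ((hB n).trans_lt hn).trans_le (pow_le_pow_right₀ one_le_two (Nat.lt_pow_self hq).le)
    have := lt_of_pow_lt_pow_left₀ _ zero_le_two hlt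
    rw [mul_div_left_comm, mul_lt_iff_lt_one_right two_pos, div_lt_one hε] at this
    rwa [dist_zero_right]
  · have hsmall : ∀ᶠ n in atTop, (‖σ.symm^[n] (a n)‖ * r) ^ q ^ n ≤ 1 := by
      filter_upwards [(tendsto_zero_iff_norm_tendsto_zero.1 h).eventually_lt_const
        (inv_pos.2 hr)] with n hn
      exact pow_le_one₀ (by positivity) ((le_inv_mul_iff₀' hr).1 (by simpa using hn.le))
    obtain ⟨B, hB⟩ := (isBoundedUnder_of_eventually_le hsmall).bddAbove_range
    exact ⟨B, fun n => hB ⟨n, rfl⟩⟩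

end Frobenius

theorem hasSum_iff_tendsto_sum_range_succ {G : Type*} [AddCommGroup G] [UniformSpace G]
    [IsUniformAddGroup G] [NonarchimedeanAddGroup G] [CompleteSpace G] [T2Space G] {f : ℕ → G}
    {a : G} : HasSum f a ↔ Tendsto (fun n => ∑ i ∈ Finset.range (n + 1), f i) atTop (𝓝 a) := by
  refine ⟨fun h => h.tendsto_sum_nat.comp (tendsto_add_atTop_nat 1), fun h => ?_⟩
  have h' := (tendsto_add_atTop_iff_nat (f := fun n => ∑ i ∈ Finset.range n, f i) 1).1 h
  have hf : Tendsto f cofinite (𝓝 0) := by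
    rw [Nat.cofinite_eq_atTop]
    simpa only [Finset.sum_range_succ, add_sub_cancel_left, sub_self] using h.sub h'
  have hsum := (NonarchimedeanAddGroup.summable_of_tendsto_cofinite_zero hf).hasSum
  rwa [tendsto_nhds_unique hsum.tendsto_sum_nat h'] at hsum

namespace TwistedSeries

section CommRing

variable {R : Type*} [CommRing R] {σ : R ≃+* R}

theorem coeff_mul_const (F : TwistedSeries σ) (b : R) (n : ℕ) :
    (F * const b).coeff n = F.coeff n * σ^[n] b := by
  change ∑ ij ∈ Finset.HasAntidiagonal.antidiagonal n,
    F.coeff ij.1 * σ^[ij.1] ((const b : TwistedSeries σ).coeff ij.2) = _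
  rw [Finset.sum_eq_single (n, 0)]
  · rfl
  · rintro ⟨i, j⟩ hij hne
    have hj : j ≠ 0 := by
      rintro rfl
      exact hne (by simpa using hij)
    rw [show (const b : TwistedSeries σ).coeff j = 0 from if_neg hj, iterate_map_zero, mul_zero]
  · simp

theorem hasEval_iff_hasSum_coeff_mul_const [TopologicalSpace R] {F : TwistedSeries σ} {x y : R} :
    F.HasEval x y ↔ HasSum (F * const x).coeff y := by
  rw [HasEval, funext (F.coeff_mul_const x)]

theorem sum_range_coeff_mul_oneSub (F : TwistedSeries σ) (n : ℕ) :
    ∑ i ∈ Finset.range (n + 1), (F * oneSub).coeff i = F.coeff n := by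
  induction n with
  | zero => rw [Finset.sum_range_one, coeff_zero_mul_oneSub]
  | succ n ih => rw [Finset.sum_range_succ, ih, coeff_succ_mul_oneSub, add_sub_cancel]

theorem coeff_eq_poonenCoeff {Fq : Type*} [Fintype Fq] (hσ : ∀ x, σ x = x ^ Fintype.card Fq)
    {F g : TwistedSeries σ} {β : R} (hg : F.adjoint * const β = g.adjoint * oneSub) :
    g.coeff = poonenCoeff Fq F.coeff β := by
  have hcoeff (n : ℕ) : σ.symm^[n] (β * F.coeff n) = (g.adjoint * oneSub).coeff n := by
    rw [← hg, coeff_mul_const, adjoint, iterate_map_mul, mul_comm]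
  funext n
  induction n with
  | zero => exact ((hcoeff 0).trans (coeff_zero_mul_oneSub _)).symm
  | succ n ih =>
    apply σ.symm.injective.iterate (n + 1)
    rw [poonenCoeff, ← ih, ← hσ, iterate_map_add, hcoeff, coeff_succ_mul_oneSub,
      Function.iterate_succ_apply _ n (σ _), RingEquiv.symm_apply_apply]
    exact (sub_add_cancel _ _).symm

/-- The kernel of the operator `F^*`: the points where it converges to zero. -/
def kerAdjoint [TopologicalSpace R] (F : TwistedSeries σ) : Set R := {β | F.adjoint.HasEval β 0}

end CommRing

theorem mem_kerAdjoint_iff_isEntire {C : Type*} [NormedField C] [IsUltrametricDist C]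
    [CompleteSpace C] {σ : C ≃+* C} {q : ℕ} (hσ : ∀ x, σ x = x ^ q) (hq : 1 < q)
    {F g : TwistedSeries σ} {β : C} (hg : F.adjoint * const β = g.adjoint * oneSub) :
    β ∈ F.kerAdjoint ↔ IsEntire q g.coeff := by
  rw [kerAdjoint, Set.mem_ofPred_eq, hasEval_iff_hasSum_coeff_mul_const, hg,
    hasSum_iff_tendsto_sum_range_succ, isEntire_iff_tendsto_symm_iterate hσ hq]
  simp only [sum_range_coeff_mul_oneSub]
  rfl

theorem hasEval_iff_hasSum_poonenCoeff {Fq C : Type*} [Fintype Fq] [NormedField C] {σ : C ≃+* C}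
    (hσ : ∀ x, σ x = x ^ Fintype.card Fq) {F g : TwistedSeries σ} {β : C}
    (hg : F.adjoint * const β = g.adjoint * oneSub) {x y : C} :
    g.HasEval x y ↔ HasSum (fun n => poonenCoeff Fq F.coeff β n * x ^ Fintype.card Fq ^ n) y := by
  simp only [HasEval, iterate_eq_pow_pow hσ, coeff_eq_poonenCoeff hσ hg]

end TwistedSeries

/-! ## Strong discreteness of finitely generated discrete lattices -/

section ProperSpace

theorem exists_finite_forall_norm_sub_le_pow {E : Type*} [NormedField E] {ϖ : E} (hϖ : ϖ ≠ 0)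
    {S : Set E} (hS : S.Finite) (hres : ∀ x : E, ‖x‖ ≤ 1 → ∃ c ∈ S, ‖x - c‖ ≤ ‖ϖ‖) (n : ℕ) :
    ∃ N : Set E, N.Finite ∧ ∀ x : E, ‖x‖ ≤ 1 → ∃ y ∈ N, ‖x - y‖ ≤ ‖ϖ‖ ^ n := by
  induction n with
  | zero => exact ⟨{0}, Set.finite_singleton 0, fun x hx => ⟨0, rfl, by simpa using hx⟩⟩
  | succ n ih =>
    obtain ⟨N, hN, h⟩ := ih
    refine ⟨Set.image2 (fun y c => y + ϖ ^ n * c) N S, hN.image2 _ hS, fun x hx => ?_⟩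
    obtain ⟨y, hy, hxy⟩ := h x hx
    obtain ⟨c, hc, hxc⟩ := hres ((x - y) / ϖ ^ n) (by
      rw [norm_div, norm_pow]
      exact div_le_one_of_le₀ hxy (by positivity))
    refine ⟨_, ⟨y, hy, c, hc, rfl⟩, ?_⟩
    calc ‖x - (y + ϖ ^ n * c)‖ = ‖ϖ ^ n * ((x - y) / ϖ ^ n - c)‖ := by
          rw [mul_sub, mul_div_cancel₀ _ (pow_ne_zero n hϖ), sub_sub]
      _ ≤ ‖ϖ‖ ^ n * ‖ϖ‖ := by
          rw [norm_mul, norm_pow]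
          gcongr
      _ = ‖ϖ‖ ^ (n + 1) := (pow_succ _ _).symm

theorem totallyBounded_closedBall_of_forall_norm_sub_le {E : Type*} [NormedField E] {ϖ : E}
    (hϖ0 : ϖ ≠ 0) (hϖ1 : ‖ϖ‖ < 1) {S : Set E} (hS : S.Finite)
    (hres : ∀ x : E, ‖x‖ ≤ 1 → ∃ c ∈ S, ‖x - c‖ ≤ ‖ϖ‖) :
    TotallyBounded (Metric.closedBall (0 : E) 1) := by
  refine Metric.totallyBounded_iff.2 fun ε hε => ?_
  obtain ⟨n, hn⟩ := exists_pow_lt_of_lt_one hε hϖ1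
  obtain ⟨N, hN, h⟩ := exists_finite_forall_norm_sub_le_pow hϖ0 hS hres n
  refine ⟨N, hN, fun x hx => ?_⟩
  obtain ⟨y, hy, hxy⟩ := h x (mem_closedBall_zero_iff.1 hx)
  exact Set.mem_biUnion hy (mem_ball_iff_norm.2 (hxy.trans_lt hn))

theorem isUltrametricDist_completion (E : Type*) [SeminormedAddCommGroup E] [IsUltrametricDist E] :
    IsUltrametricDist (UniformSpace.Completion E) :=
  IsUltrametricDist.isUltrametricDist_of_forall_norm_add_le_max_norm fun x y => by
    induction x, y using UniformSpace.Completion.induction_on₂ with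
    | hp => exact isClosed_le (by fun_prop) (by fun_prop)
    | ih x y =>
      rw [← UniformSpace.Completion.coe_add]
      simpa only [UniformSpace.Completion.norm_coe] using IsUltrametricDist.norm_add_le_max x y

theorem closedBall_zero_subset_closure_image_coe {E : Type*} [SeminormedAddCommGroup E]
    [IsUltrametricDist E] {r : ℝ} (hr : 0 < r) :
    Metric.closedBall (0 : UniformSpace.Completion E) r ⊆
      closure ((↑) '' Metric.closedBall (0 : E) r) := by
  have := isUltrametricDist_completion E
  have hopen := IsUltrametricDist.isOpen_closedBall (0 : UniformSpace.Completion E) hr.ne'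
  refine (UniformSpace.Completion.denseRange_coe.open_subset_closure_inter hopen).trans
    (closure_mono ?_)
  rintro _ ⟨hx, x, rfl⟩
  refine ⟨x, ?_, rfl⟩
  rwa [mem_closedBall_zero_iff, UniformSpace.Completion.norm_coe,
    ← mem_closedBall_zero_iff] at hx

theorem totallyBounded_closedBall_completion {E : Type*} [SeminormedAddCommGroup E]
    [IsUltrametricDist E] {r : ℝ} (hr : 0 < r) (h : TotallyBounded (Metric.closedBall (0 : E) r)) :
    TotallyBounded (Metric.closedBall (0 : UniformSpace.Completion E) r) :=
  (h.image (UniformSpace.Completion.uniformContinuous_coe E)).closure.subset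
    (closedBall_zero_subset_closure_image_coe hr)

theorem properSpace_of_totallyBounded_closedBall {F : Type*} [NontriviallyNormedField F]
    [CompleteSpace F] {r : ℝ} (hr : 0 < r) (h : TotallyBounded (Metric.closedBall (0 : F) r)) :
    ProperSpace F := by
  have hc : IsCompact (Metric.closedBall (0 : F) r) :=
    isCompact_iff_totallyBounded_isComplete.2 ⟨h, Metric.isClosed_closedBall.isComplete⟩
  have := hc.locallyCompactSpace_of_mem_nhds_of_addGroup (Metric.closedBall_mem_nhds 0 hr)
  exact ProperSpace.of_nontriviallyNormedField_of_weaklyLocallyCompactSpace F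

end ProperSpace

theorem StronglyDiscrete.of_discreteTopology {R E : Type*} [Ring R] [SeminormedAddCommGroup E]
    [Module R E] [T2Space E] [ProperSpace E] (L : Submodule R E) [DiscreteTopology L] :
    StronglyDiscrete L := fun r => by
  have hclosed : IsClosed (L : Set E) :=
    have : DiscreteTopology L.toAddSubgroup := ‹_›
    L.toAddSubgroup.isClosed_of_discrete
  refine (Metric.finite_isBounded_inter_isClosed ⟨‹_›⟩
    (Metric.isBounded_closedBall (x := (0 : E)) (r := r)) hclosed).subset ?_
  exact fun x ⟨hx, hxr⟩ => ⟨mem_closedBall_zero_iff.2 hxr, hx⟩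

theorem StronglyDiscrete.of_fg {A F C : Type*} [Ring A] [NontriviallyNormedField F]
    [ProperSpace F] [NormedField C] [NormedAlgebra F C] [Module A C]
    (hA : ∀ a : A, ∃ c : F, ∀ x : C, a • x = c • x) {L : Submodule A C} (hfg : L.FG)
    [DiscreteTopology L] : StronglyDiscrete L := by
  obtain ⟨S, rfl⟩ := hfg
  let V : Submodule F C := Submodule.span F S
  have hLV : ∀ x ∈ Submodule.span A (S : Set C), x ∈ V := fun x hx => by
    induction hx using Submodule.span_induction with
    | mem x hx => exact Submodule.subset_span hx
    | zero => exact V.zero_mem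
    | add x y _ _ hx hy => exact V.add_mem hx hy
    | smul a x _ hx =>
      obtain ⟨c, hc⟩ := hA a
      exact hc x ▸ V.smul_mem c hx
  have := FiniteDimensional.span_finset F S
  have := FiniteDimensional.proper F V
  let G : Submodule ℤ V := ((Submodule.span A (S : Set C)).toAddSubgroup.comap
    V.subtype.toAddMonoidHom).toIntSubmodule
  have : DiscreteTopology G :=
    DiscreteTopology.preimage_of_continuous_injective (Submodule.span A (S : Set C) : Set C)
      continuous_subtype_val Subtype.val_injective
  intro r
  refine ((StronglyDiscrete.of_discreteTopology G r).image Subtype.val).subset ?_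
  rintro x ⟨hx, hxr⟩
  exact ⟨⟨x, hLV x hx⟩, ⟨hx, hxr⟩, rfl⟩

namespace ClosedPoint

variable {Fq K : Type*} [Field Fq] [Field K] [Algebra Fq K] [Fintype Fq] {P : ClosedPoint Fq K}

theorem mem_localRing_of_abv_le_one {x : K} (hx : P.abv x ≤ 1) : x ∈ P.localRing := by
  have hval := (WithZeroMulInt.toNNReal_le_one_iff (e := (Fintype.card Fq : NNReal))
    (by exact_mod_cast Fintype.one_lt_card)).1 (by exact_mod_cast hx)
  obtain ⟨a, rfl⟩ := IsDiscreteValuationRing.exists_lift_of_le_one hval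
  exact a.2

theorem IsRational.exists_abv_sub_le (hP : P.IsRational) {ϖ : P.localRing} (hϖ : Irreducible ϖ)
    {x : K} (hx : P.abv x ≤ 1) : ∃ c : Fq, P.abv (x - algebraMap Fq K c) ≤ P.abv (ϖ : K) := by
  have hx' := mem_localRing_of_abv_le_one hx
  obtain ⟨c, hc⟩ := hP x hx'
  let a : P.localRing := ⟨x, hx'⟩ - ⟨algebraMap Fq K c, P.algebraMap_mem c⟩
  have ha : a ∈ IsLocalRing.maximalIdeal P.localRing := (P.localRing.valuation_lt_one_iff a).2 hc
  rw [hϖ.maximalIdeal_eq, Ideal.mem_span_singleton] at ha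
  obtain ⟨b, hb⟩ := ha
  have hmul : x - algebraMap Fq K c = ϖ * b := congrArg Subtype.val hb
  refine ⟨c, ?_⟩
  rw [hmul, map_mul]
  exact mul_le_of_le_one_right (P.abv.nonneg _)
    (IsDedekindDomain.HeightOneSpectrum.adicAbv_coe_le_one _ _ b)

theorem IsRational.properSpace_KInf (hP : P.IsRational) : ProperSpace P.KInf := by
  obtain ⟨ϖ, hϖ⟩ := IsDiscreteValuationRing.exists_irreducible P.localRing
  have hϖ1 : P.abv (ϖ : K) < 1 :=
    (IsDedekindDomain.HeightOneSpectrum.adicAbv_coe_lt_one_iff _ _ ϖ).2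
      (hϖ.maximalIdeal_eq.ge (Ideal.mem_span_singleton_self ϖ))
  have hϖ0 : WithAbs.toAbs P.abv (ϖ : K) ≠ 0 := fun h =>
    hϖ.ne_zero (Subtype.ext ((WithAbs.equiv P.abv).symm.map_eq_zero_iff.1 h))
  refine properSpace_of_totallyBounded_closedBall one_pos
    (totallyBounded_closedBall_completion one_pos
      (totallyBounded_closedBall_of_forall_norm_sub_le hϖ0 hϖ1
        (Set.finite_range fun c : Fq => WithAbs.toAbs P.abv (algebraMap Fq K c)) fun x hx => ?_))
  obtain ⟨c, hc⟩ := hP.exists_abv_sub_le hϖ (x := x.ofAbs) hx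
  exact ⟨_, ⟨c, rfl⟩, hc⟩

instance (P : ClosedPoint Fq K) : IsUltrametricDist P.KInfAlg :=
  IsUltrametricDist.isUltrametricDist_of_forall_norm_add_le_max_norm
    (isNonarchimedean_spectralNorm (K := P.KInf) (L := P.KInfAlg))

instance (P : ClosedPoint Fq K) : IsUltrametricDist P.CInf :=
  isUltrametricDist_completion P.KInfAlg

theorem norm_algebraMap_KInf (x : P.KInf) :
    ‖algebraMap P.KInfAlg P.CInf (algebraMap P.KInf P.KInfAlg x)‖ = ‖x‖ :=
  (UniformSpace.Completion.norm_coe (algebraMap P.KInf P.KInfAlg x)).trans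
    (spectralNorm_extends x)

theorem IsRational.stronglyDiscrete (hP : P.IsRational) {Λ : Submodule P.ringAway P.CInf}
    (hfg : Λ.FG) [DiscreteTopology Λ] : StronglyDiscrete Λ := by
  have := hP.properSpace_KInf
  let _ : NormedAlgebra P.KInf P.CInf :=
    { ((algebraMap P.KInfAlg P.CInf).comp (algebraMap P.KInf P.KInfAlg)).toAlgebra with
      norm_smul_le := fun a x =>
        (norm_mul_le _ _).trans_eq (by rw [← norm_algebraMap_KInf a]; rfl) }
  have hsmul (a : P.ringAway) : ∃ c : P.KInf, ∀ x : P.CInf, a • x = c • x :=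
    ⟨algebraMap (WithAbs P.abv) P.KInf (WithAbs.toAbs P.abv a), fun _ => rfl⟩
  exact .of_fg hsmul hfg

end ClosedPoint

/-! ## Poonen's duality -/

section PoonenDuality

variable {Fq C : Type*} [Field Fq] [Fintype Fq] [NormedField C] [Algebra Fq C] {σ : C ≃+* C}
  {L : Submodule Fq C}

variable (σ L) in
/-- The exponential of `L` as the twisted series `∑ eₙ σⁿ`; it is meant for `σ : x ↦ x ^ q`. -/
def latticeExpSeries : TwistedSeries σ := ⟨expCoeff Fq L⟩

namespace StronglyDiscrete

variable [IsUltrametricDist C] [CompleteSpace C]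

theorem exists_linearMap_hasEval (hL : StronglyDiscrete L) (hσ : ∀ x, σ x = x ^ Fintype.card Fq)
    {g : TwistedSeries σ} {β : C}
    (hg : (latticeExpSeries σ L).adjoint * .const β = g.adjoint * .oneSub)
    (hβ : β ∈ (latticeExpSeries σ L).kerAdjoint) :
    ∃ f : L →ₗ[Fq] Fq, (∀ l : L, g.HasEval (l : C) (algebraMap Fq C (f l))) ∧
      HasSum (fun l : {l : L // l ≠ 0} => algebraMap Fq C (f l) / (l : C)) (-β) := by
  rw [TwistedSeries.mem_kerAdjoint_iff_isEntire hσ Fintype.one_lt_card hg,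
    TwistedSeries.coeff_eq_poonenCoeff hσ hg] at hβ
  obtain ⟨f, hf⟩ := exists_linearMap_hasSum fun l : L =>
    exists_hasSum_poonenCoeff_algebraMap hβ (hL.hasSum_expCoeff l.2)
  exact ⟨f, fun l => (TwistedSeries.hasEval_iff_hasSum_poonenCoeff hσ hg).2 (hf l),
    hL.hasSum_algebraMap_div hβ hf⟩

theorem exists_mem_kerAdjoint_hasEval (hL : StronglyDiscrete L)
    (hσ : ∀ x, σ x = x ^ Fintype.card Fq) {g : C → TwistedSeries σ}
    (hg : ∀ β, (latticeExpSeries σ L).adjoint * .const β = (g β).adjoint * .oneSub)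
    (f : L →ₗ[Fq] Fq) :
    ∃ β ∈ (latticeExpSeries σ L).kerAdjoint,
      (∀ l : L, (g β).HasEval (l : C) (algebraMap Fq C (f l))) ∧
      HasSum (fun l : {l : L // l ≠ 0} => algebraMap Fq C (f l) / (l : C)) (-β) := by
  have hsum := (hL.summable_algebraMap_div f).hasSum
  rw [← neg_neg (tsum _)] at hsum
  refine ⟨_, ?_, fun l => ?_, hsum⟩
  · rw [TwistedSeries.mem_kerAdjoint_iff_isEntire hσ Fintype.one_lt_card (hg _),
      TwistedSeries.coeff_eq_poonenCoeff hσ (hg _)]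
    exact hL.isEntire_poonenCoeff f hsum
  · exact (TwistedSeries.hasEval_iff_hasSum_poonenCoeff hσ (hg _)).2
      (hL.hasSum_poonenCoeff f hsum l)

end StronglyDiscrete

end PoonenDuality

theorem mainTheorem8_general {Fq C : Type*} [Field Fq] [Fintype Fq] [NormedField C]
    [IsUltrametricDist C] [CompleteSpace C] [Algebra Fq C] {σ : C ≃+* C}
    (hσ : ∀ x, σ x = x ^ Fintype.card Fq) {L : Submodule Fq C} (hL : StronglyDiscrete L)
    {g : C → TwistedSeries σ}
    (hg : ∀ β, (latticeExpSeries σ L).adjoint * .const β = (g β).adjoint * .oneSub) :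
    (∀ β ∈ (latticeExpSeries σ L).kerAdjoint,
      (∀ l : L, ∃ y, (g β).HasEval (l : C) y) ∧
      HasSum (fun l : {l : L // l ≠ 0} => (g β).eval (l : C) / (l : C)) (-β)) ∧
    ∃ e : (latticeExpSeries σ L).kerAdjoint ≃ (L →ₗ[Fq] Fq),
      (∀ (β : (latticeExpSeries σ L).kerAdjoint) (l : L),
        (g β).HasEval (l : C) (algebraMap Fq C (e β l))) ∧
      ∀ f : L →ₗ[Fq] Fq,
        HasSum (fun l : {l : L // l ≠ 0} => algebraMap Fq C (f l) / (l : C))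
          (-(e.symm f : C)) := by
  have hker (β : (latticeExpSeries σ L).kerAdjoint) :=
    hL.exists_linearMap_hasEval hσ (hg β) β.2
  choose toMap heval hsum using hker
  choose ofMap hmem heval' hsum' using hL.exists_mem_kerAdjoint_hasEval hσ hg
  refine ⟨fun β hβ => ⟨fun l => ⟨_, heval ⟨β, hβ⟩ l⟩, ?_⟩,
    ⟨toMap, fun f => ⟨ofMap f, hmem f⟩, fun β => ?_, fun f => ?_⟩, heval, hsum'⟩
  · exact (hsum ⟨β, hβ⟩).congr_fun fun l => by
      rw [TwistedSeries.eval, (heval ⟨β, hβ⟩ l).tsum_eq]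
  · exact Subtype.ext (neg_injective ((hsum' (toMap β)).unique (hsum β)))
  · exact LinearMap.ext fun l => (algebraMap Fq C).injective
      ((heval ⟨ofMap f, hmem f⟩ l).unique (heval' f l))

end

theorem mainTheorem8 {Fq K : Type*} [Field Fq] [Fintype Fq] [Field K] [Algebra Fq K]
    (hK : IsCurveFunctionField Fq K) (P : ClosedPoint Fq K) (hP : P.IsRational)
    (Λ : Submodule P.ringAway P.CInf) (hfg : Λ.FG) (hdisc : DiscreteTopology Λ) :
    (∀ β ∈ ClosedPoint.kerDualExp Λ, β ≠ 0 →
      (∀ l : Λ, ∃ y, (ClosedPoint.poonenSeries Λ β).HasEval (l : P.CInf) y) ∧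
      HasSum (fun l : {l : Λ // l ≠ 0} =>
        (ClosedPoint.poonenSeries Λ β).eval ((l : Λ) : P.CInf) / ((l : Λ) : P.CInf)) (-β)) ∧
    ∃ e : ClosedPoint.kerDualExp Λ ≃ (Λ →ₗ[Fq] Fq),
      (∀ (β : ClosedPoint.kerDualExp Λ) (l : Λ),
        (ClosedPoint.poonenSeries Λ β).HasEval (l : P.CInf) (algebraMap Fq P.CInf (e β l))) ∧
      ∀ f : Λ →ₗ[Fq] Fq,
        HasSum (fun l : {l : Λ // l ≠ 0} =>
          algebraMap Fq P.CInf (f l) / ((l : Λ) : P.CInf)) (-(e.symm f : P.CInf)) := by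
  have hL : StronglyDiscrete (Λ.restrictScalars Fq) := hP.stronglyDiscrete hfg
  obtain ⟨hsum, hbij⟩ := mainTheorem8_general (fun _ => rfl) hL (ClosedPoint.poonenSeries_spec Λ)
  exact ⟨fun β hβ _ => hsum β hβ, hbij⟩
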